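/- Let $n\ge 0$ be an integer, $\alpha>0$, and let $X_0\sim\sum_{i=1}^k p_i\,\delta_{\mu_i}$ be a random variable in $\mathbb{R}^n$ whose law is a finite mixture of point masses at distinct centers $\mu_1,\dots,\mu_k\in\mathbb{R}^n$, with weights $p_i>0$ and $\sum_{i=1}^k p_i=1$. Let $(X_t)_{t\ge 0}$ be the Ornstein--Uhlenbeck process started at $X_0$, i.e. the solution with continuous paths of $$dX_t=-\alpha X_t\,dt+\sqrt{2}\,dW_t ,$$ where $W$ is a standard Brownian motion in $\mathbb{R}^n$ with $W_0=0$, independent of $X_0$ (its stationary measure is $\mathcal{N}(0,\tfrac1\alpha I)$). Let $I(X_0;X_t)$ denote the mutual information of $X_0$ and $X_t$, i.e. the Kullback--Leibler divergence of the joint law of $(X_0,X_t)$ from the product of its marginals. Then $I(X_0;X_t)$ is finite for every $t\ge 0$, the function $t\mapsto I(X_0;X_t)$ is infinitely differentiable on $(0,\infty)$, and for every integer $\ell\ge 1$, $$\lim_{t\to 0^+}\frac{d^\ell}{dt^\ell}\,I(X_0;X_t)=0 .$$ -/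

import Mathlib

open MeasureTheory ProbabilityTheory Filter Topology
open scoped NNReal ENNReal

/-- Standard Brownian motion in `ℝⁿ` started at the origin: the coordinates are independent
standard real Brownian motions (for which `W 0 = 0` almost surely). -/
structure IsStandardBrownianMotion {Ω : Type*} [MeasurableSpace Ω] {n : ℕ}
    (W : ℝ≥0 → Ω → EuclideanSpace ℝ (Fin n)) (P : Measure Ω) : Prop where
  measurable : ∀ t, Measurable (W t)
  isBrownianReal : ∀ i : Fin n, IsBrownianReal (fun t ω => W t ω i) P
  iIndepFun : iIndepFun (fun (i : Fin n) (ω : Ω) (t : ℝ≥0) => W t ω i) P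

/-- `X` is an Ornstein-Uhlenbeck process in `ℝⁿ` with parameter `α` (target measure
`N(0, α⁻¹ I)`) driven by `W`: a solution with continuous paths of the stochastic differential
equation `dX = -α X dt + √2 dW`, where `W` is a standard Brownian motion independent of `X 0`.
The noise being additive, the equation is the pathwise integral equation
`X t = X 0 - ∫₀ᵗ α X s ds + √2 W t`. -/
structure IsOUProcess {Ω : Type*} [MeasurableSpace Ω] {n : ℕ} (α : ℝ)
    (X W : ℝ≥0 → Ω → EuclideanSpace ℝ (Fin n)) (P : Measure Ω) : Prop where
  brownian : IsStandardBrownianMotion W P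
  measurable : ∀ t, Measurable (X t)
  indep : IndepFun (X 0) (fun (ω : Ω) (t : ℝ≥0) => W t ω) P
  continuous_paths : ∀ᵐ ω ∂P, Continuous (fun t => X t ω)
  equation : ∀ᵐ ω ∂P, ∀ t : ℝ≥0,
    X t ω = X 0 ω + (∫ s in (0 : ℝ)..(t : ℝ), (-α) • X s.toNNReal ω) + √2 • W t ω

/-- The mutual information `I(X;Y)`: the Kullback-Leibler divergence (natural logarithm) of the
joint law of `(X, Y)` from the product of the marginal laws. -/
noncomputable def mutualInfo {Ω E F : Type*} [MeasurableSpace Ω] [MeasurableSpace E]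
    [MeasurableSpace F] (X : Ω → E) (Y : Ω → F) (P : Measure Ω) : ℝ≥0∞ :=
  InformationTheory.klDiv (P.map (fun ω => (X ω, Y ω))) ((P.map X).prod (P.map Y))

/-! Solving the equation gives X_t = e^{-αt}(X_0 + √2 ∫₀ᵗ e^{αs} dW_s). The Wiener integral is a
centred Gaussian independent of X_0, so for t > 0 the pair (X_0, X_t) has the law of (X_0, σ(a X_0 +
Z)) with Z standard Gaussian, σ ≠ 0 and a = `ouScale α t` (`IsOUProcess.map_prodMk`). Mutual
information ignores σ, and the Cameron–Martin formula makes it the Gaussian expectation of ∑ p_i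
ι_i(a, Z), where ι_i is `infoDensity` (`toReal_mutualInfo`). As t → 0⁺, a → ∞.

The derivative of ι_i in a is a combination of posterior probabilities in which the true component
drops out, its log-ratio being identically 0. It therefore lies in the ideal `Decaying` of the
algebra `Tame`. Both are stable under d/da, since the derivative of a posterior is a multiple of
that posterior, and under d/dt, since da/dt = -a(a² + α) is a polynomial in a.

Tame functions grow polynomially, so one may differentiate under the Gaussian integral; this gives
smoothness. A wrong posterior is at most of order e^{-ca²} unless ‖Z‖ is at least comparable to a,
so it beats every power of a (`exists_posterior_mul_pow_le`). Expectations of decaying functions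
thus tend to 0, and with them all time derivatives of order at least one. Finiteness is separate: it
uses only the finite support of X_0. -/

namespace PointMixture

/-! ### The differential algebra of posteriors and information densities. -/

variable {E : Type*} [NormedAddCommGroup E] [InnerProductSpace ℝ E] {k : ℕ}

/-- Log-likelihood ratio of `a • x j + Z` against `a • x i + Z`, `Z` standard Gaussian, evaluated
at `a • x i + z`. -/
noncomputable def logRatio (x : Fin k → E) (i j : Fin k) (a : ℝ) (z : E) : ℝ :=
  a * inner ℝ (x j - x i) z - a ^ 2 * ‖x j - x i‖ ^ 2 / 2

/-- The derivative of `logRatio` in the scale parameter. -/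
noncomputable def logRatioDeriv (x : Fin k → E) (i j : Fin k) (a : ℝ) (z : E) : ℝ :=
  inner ℝ (x j - x i) z - a * ‖x j - x i‖ ^ 2

/-- Density of the mixture relative to its `i`-th component. -/
noncomputable def mixRatio (p : Fin k → ℝ) (x : Fin k → E) (i : Fin k) (a : ℝ) (z : E) : ℝ :=
  ∑ j, p j * Real.exp (logRatio x i j a z)

/-- Posterior probability of the `j`-th component when the observation is `a • x i + z`. -/
noncomputable def posterior (p : Fin k → ℝ) (x : Fin k → E) (i j : Fin k) (a : ℝ) (z : E) : ℝ :=
  p j * Real.exp (logRatio x i j a z) / mixRatio p x i a z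

/-- Information density of the `i`-th component. -/
noncomputable def infoDensity (p : Fin k → ℝ) (x : Fin k → E) (i : Fin k) (a : ℝ) (z : E) : ℝ :=
  -Real.log (mixRatio p x i a z)

/-- The algebra generated by the scale, the linear forms, the posterior probabilities and the
information densities. It is stable under differentiation in the scale. -/
inductive Tame (p : Fin k → ℝ) (x : Fin k → E) : (ℝ → E → ℝ) → Prop
  | const (c : ℝ) : Tame p x fun _ _ => c
  | scale : Tame p x fun a _ => a
  | lin (v : E) : Tame p x fun _ z => inner ℝ v z
  | posterior (i j : Fin k) : Tame p x (posterior p x i j)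
  | infoDensity (i : Fin k) : Tame p x (infoDensity p x i)
  | add {f g : ℝ → E → ℝ} : Tame p x f → Tame p x g → Tame p x fun a z => f a z + g a z
  | mul {f g : ℝ → E → ℝ} : Tame p x f → Tame p x g → Tame p x fun a z => f a z * g a z

/-- The ideal of `Tame` generated by the posterior probabilities of the wrong components. -/
inductive Decaying (p : Fin k → ℝ) (x : Fin k → E) : (ℝ → E → ℝ) → Prop
  | zero : Decaying p x fun _ _ => 0
  | mul {i j : Fin k} {f : ℝ → E → ℝ} : i ≠ j → Tame p x f →
      Decaying p x fun a z => posterior p x i j a z * f a z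
  | add {f g : ℝ → E → ℝ} : Decaying p x f → Decaying p x g →
      Decaying p x fun a z => f a z + g a z

section Derivatives

variable {p : Fin k → ℝ} {x : Fin k → E}

lemma Tame.sum {ι : Type*} (s : Finset ι) {f : ι → ℝ → E → ℝ} (h : ∀ l, Tame p x (f l)) :
    Tame p x fun a z => ∑ l ∈ s, f l a z := by
  classical
  induction s using Finset.induction_on with
  | empty => simpa using Tame.const 0
  | insert l s hl ih => simpa [Finset.sum_insert hl] using (h l).add ih

lemma Decaying.sum {ι : Type*} (s : Finset ι) {f : ι → ℝ → E → ℝ} (h : ∀ l, Decaying p x (f l)) :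
    Decaying p x fun a z => ∑ l ∈ s, f l a z := by
  classical
  induction s using Finset.induction_on with
  | empty => simpa using Decaying.zero
  | insert l s hl ih => simpa [Finset.sum_insert hl] using (h l).add ih

lemma Decaying.tame {f : ℝ → E → ℝ} (h : Decaying p x f) : Tame p x f := by
  induction h with
  | zero => exact .const 0
  | mul _ hf => exact (Tame.posterior _ _).mul hf
  | add _ _ h₁ h₂ => exact h₁.add h₂

lemma Decaying.mul_tame {f g : ℝ → E → ℝ} (hf : Decaying p x f) (hg : Tame p x g) :
    Decaying p x fun a z => f a z * g a z := by
  induction hf with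
  | zero => simpa using Decaying.zero
  | mul hij hf => simpa only [mul_assoc] using Decaying.mul hij (hf.mul hg)
  | add _ _ h₁ h₂ => simpa only [add_mul] using h₁.add h₂

lemma tame_logRatioDeriv (i j : Fin k) : Tame p x (logRatioDeriv x i j) := by
  have h : Tame p x fun a z => inner ℝ (x j - x i) z + a * -‖x j - x i‖ ^ 2 :=
    (Tame.lin _).add (Tame.scale.mul (.const _))
  convert h using 3
  simp only [logRatioDeriv]
  ring

lemma hasDerivAt_logRatio (i j : Fin k) (a : ℝ) (z : E) :
    HasDerivAt (fun a => logRatio x i j a z) (logRatioDeriv x i j a z) a := by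
  have h := ((hasDerivAt_id a).mul_const (inner ℝ (x j - x i) z)).sub
    ((((hasDerivAt_id a).pow 2).mul_const (‖x j - x i‖ ^ 2)).div_const 2)
  refine h.congr_deriv ?_
  simp [logRatioDeriv]
  ring

@[simp]
lemma logRatio_self (i : Fin k) (a : ℝ) (z : E) : logRatio x i i a z = 0 := by simp [logRatio]

@[simp]
lemma logRatioDeriv_self (i : Fin k) (a : ℝ) (z : E) : logRatioDeriv x i i a z = 0 := by
  simp [logRatioDeriv]

/-- This is the logarithmic derivative in the scale of `posterior p x i j`, a softmax of the
log-ratios. -/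
lemma tame_posterior_deriv (i j : Fin k) : Tame p x fun a z => logRatioDeriv x i j a z
    + (-1) * ∑ l, posterior p x i l a z * logRatioDeriv x i l a z :=
  (tame_logRatioDeriv i j).add ((Tame.const _).mul
    (Tame.sum _ fun l => (Tame.posterior i l).mul (tame_logRatioDeriv i l)))

/-- The term j = i vanishes by `logRatioDeriv_self`, so only wrong posteriors remain. This is where
the decay enters. -/
lemma decaying_infoDensity_deriv (i : Fin k) : Decaying p x fun a z =>
    ∑ j, posterior p x i j a z * logRatioDeriv x i j a z * (-1) := by
  refine Decaying.sum _ fun j => ?_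
  by_cases hij : i = j
  · subst hij
    simpa using Decaying.zero
  · simpa only [mul_assoc] using Decaying.mul hij ((tame_logRatioDeriv i j).mul (.const (-1)))

variable (hp : ∀ i, 0 < p i)
include hp

lemma le_mixRatio (i j : Fin k) (a : ℝ) (z : E) :
    p j * Real.exp (logRatio x i j a z) ≤ mixRatio p x i a z :=
  Finset.single_le_sum (f := fun j => p j * Real.exp (logRatio x i j a z))
    (fun l _ => (mul_pos (hp l) (Real.exp_pos _)).le) (Finset.mem_univ j)

/-- The i-th summand is exactly p i, a lower bound uniform in the scale and in z. -/
lemma weight_le_mixRatio (i : Fin k) (a : ℝ) (z : E) : p i ≤ mixRatio p x i a z := by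
  simpa using le_mixRatio hp (x := x) i i a z

lemma mixRatio_pos (i : Fin k) (a : ℝ) (z : E) : 0 < mixRatio p x i a z :=
  (hp i).trans_le (weight_le_mixRatio hp i a z)

lemma posterior_nonneg (i j : Fin k) (a : ℝ) (z : E) : 0 ≤ posterior p x i j a z :=
  div_nonneg (mul_pos (hp j) (Real.exp_pos _)).le (mixRatio_pos hp i a z).le

lemma posterior_le_one (i j : Fin k) (a : ℝ) (z : E) : posterior p x i j a z ≤ 1 :=
  div_le_one_of_le₀ (le_mixRatio hp i j a z) (mixRatio_pos hp i a z).le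

lemma hasDerivAt_mixRatio (i : Fin k) (a : ℝ) (z : E) :
    HasDerivAt (fun a => mixRatio p x i a z)
      (mixRatio p x i a z * ∑ j, posterior p x i j a z * logRatioDeriv x i j a z) a := by
  have h := HasDerivAt.fun_sum (u := Finset.univ) fun j _ =>
    ((hasDerivAt_logRatio (x := x) i j a z).exp.const_mul (p j))
  refine h.congr_deriv ?_
  rw [Finset.mul_sum]
  refine Finset.sum_congr rfl fun j _ => ?_
  have := (mixRatio_pos hp (x := x) i a z).ne'
  simp only [posterior]
  field_simp

lemma hasDerivAt_posterior (i j : Fin k) (a : ℝ) (z : E) :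
    HasDerivAt (fun a => posterior p x i j a z)
      (posterior p x i j a z * (logRatioDeriv x i j a z
        + (-1) * ∑ l, posterior p x i l a z * logRatioDeriv x i l a z)) a := by
  have h := ((hasDerivAt_logRatio (x := x) i j a z).exp.const_mul (p j)).div
    (hasDerivAt_mixRatio hp (x := x) i a z) (mixRatio_pos hp i a z).ne'
  refine h.congr_deriv ?_
  have := (mixRatio_pos hp (x := x) i a z).ne'
  simp only [posterior]
  field_simp
  ring

lemma hasDerivAt_infoDensity (i : Fin k) (a : ℝ) (z : E) :
    HasDerivAt (fun a => infoDensity p x i a z)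
      (∑ j, posterior p x i j a z * logRatioDeriv x i j a z * (-1)) a := by
  have h := ((hasDerivAt_mixRatio hp (x := x) i a z).log (mixRatio_pos hp i a z).ne').neg
  refine h.congr_deriv ?_
  have := (mixRatio_pos hp (x := x) i a z).ne'
  rw [mul_div_cancel_left₀ _ this, ← Finset.sum_neg_distrib]
  simp

lemma Tame.exists_deriv {f : ℝ → E → ℝ} (hf : Tame p x f) :
    ∃ g, Tame p x g ∧ ∀ a z, HasDerivAt (fun a => f a z) (g a z) a := by
  induction hf with
  | const c => exact ⟨_, .const 0, fun a z => hasDerivAt_const a c⟩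
  | scale => exact ⟨_, .const 1, fun a z => hasDerivAt_id a⟩
  | lin v => exact ⟨_, .const 0, fun a z => hasDerivAt_const a _⟩
  | posterior i j => exact ⟨_, (Tame.posterior i j).mul (tame_posterior_deriv i j),
      fun a z => hasDerivAt_posterior hp i j a z⟩
  | infoDensity i => exact ⟨_, (decaying_infoDensity_deriv i).tame,
      fun a z => hasDerivAt_infoDensity hp i a z⟩
  | add _ _ h₁ h₂ =>
    obtain ⟨g₁, t₁, d₁⟩ := h₁
    obtain ⟨g₂, t₂, d₂⟩ := h₂
    exact ⟨_, t₁.add t₂, fun a z => (d₁ a z).add (d₂ a z)⟩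
  | mul hf hg h₁ h₂ =>
    obtain ⟨g₁, t₁, d₁⟩ := h₁
    obtain ⟨g₂, t₂, d₂⟩ := h₂
    exact ⟨_, (t₁.mul hg).add (hf.mul t₂), fun a z => (d₁ a z).mul (d₂ a z)⟩

/-- Differentiating a wrong posterior returns it times a tame factor, so the Leibniz rule never
loses the small factor. -/
lemma Decaying.exists_deriv {f : ℝ → E → ℝ} (hf : Decaying p x f) :
    ∃ g, Decaying p x g ∧ ∀ a z, HasDerivAt (fun a => f a z) (g a z) a := by
  induction hf with
  | zero => exact ⟨_, .zero, fun a z => hasDerivAt_const a 0⟩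
  | @mul i j f hij hf =>
    obtain ⟨g, t, d⟩ := hf.exists_deriv hp
    refine ⟨_, .mul hij (((tame_posterior_deriv i j).mul hf).add t), fun a z => ?_⟩
    exact ((hasDerivAt_posterior hp i j a z).mul (d a z)).congr_deriv (by ring)
  | add _ _ h₁ h₂ =>
    obtain ⟨g₁, t₁, d₁⟩ := h₁
    obtain ⟨g₂, t₂, d₂⟩ := h₂
    exact ⟨_, t₁.add t₂, fun a z => (d₁ a z).add (d₂ a z)⟩

end Derivatives

/-! ### Polynomial growth of tame functions and decay of wrong posteriors. -/

section Bounds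

variable {p : Fin k → ℝ} {x : Fin k → E}

lemma continuous_logRatio (i j : Fin k) (a : ℝ) : Continuous (logRatio x i j a) := by
  unfold logRatio
  fun_prop

lemma abs_logRatio_le (i j : Fin k) (a : ℝ) (z : E) :
    |logRatio x i j a z| ≤
      (‖x j - x i‖ + ‖x j - x i‖ ^ 2 / 2) * (1 + |a| + ‖z‖) ^ 2 := by
  have h₁ : |inner ℝ (x j - x i) z| ≤ ‖x j - x i‖ * ‖z‖ := abs_real_inner_le_norm _ _
  have h₂ : |logRatio x i j a z| ≤ |a| * (‖x j - x i‖ * ‖z‖) + |a| ^ 2 * ‖x j - x i‖ ^ 2 / 2 := by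
    refine (abs_sub _ _).trans ?_
    rw [abs_mul, abs_of_nonneg (show 0 ≤ a ^ 2 * ‖x j - x i‖ ^ 2 / 2 by positivity), sq_abs]
    gcongr
  refine h₂.trans ?_
  have ha := abs_nonneg a
  have hz := norm_nonneg z
  have h₃ : |a| * ‖z‖ ≤ (1 + |a| + ‖z‖) ^ 2 := by nlinarith
  have h₄ : |a| ^ 2 ≤ (1 + |a| + ‖z‖) ^ 2 := by nlinarith
  calc |a| * (‖x j - x i‖ * ‖z‖) + |a| ^ 2 * ‖x j - x i‖ ^ 2 / 2
      = ‖x j - x i‖ * (|a| * ‖z‖) + ‖x j - x i‖ ^ 2 / 2 * |a| ^ 2 := by ring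
    _ ≤ ‖x j - x i‖ * (1 + |a| + ‖z‖) ^ 2 + ‖x j - x i‖ ^ 2 / 2 * (1 + |a| + ‖z‖) ^ 2 := by gcongr
    _ = _ := by ring

lemma continuous_mixRatio (i : Fin k) (a : ℝ) : Continuous (mixRatio p x i a) :=
  continuous_finsetSum _ fun j _ => continuous_const.mul (continuous_logRatio i j a).rexp

variable (hp : ∀ i, 0 < p i)
include hp

lemma Tame.continuous {f : ℝ → E → ℝ} (hf : Tame p x f) (a : ℝ) : Continuous (f a) := by
  induction hf with
  | const c => fun_prop
  | scale => fun_prop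
  | lin v => fun_prop
  | posterior i j =>
    exact (continuous_const.mul (continuous_logRatio i j a).rexp).div
      (continuous_mixRatio i a) fun z => (mixRatio_pos hp i a z).ne'
  | infoDensity i =>
    exact ((continuous_mixRatio i a).log
        fun z => (mixRatio_pos hp i a z).ne').neg
  | add _ _ h₁ h₂ => exact h₁.add h₂
  | mul _ _ h₁ h₂ => exact h₁.mul h₂

/-- The mixture ratio is at least p i and, being a weighted average, at most the largest likelihood
ratio, whose logarithm grows quadratically. -/
lemma abs_infoDensity_le (hp_sum : ∑ i, p i = 1) (i : Fin k) : ∃ C, ∀ a z,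
    |infoDensity p x i a z| ≤ C * (1 + |a| + ‖z‖) ^ 2 := by
  set K : ℝ := ∑ j, (‖x j - x i‖ + ‖x j - x i‖ ^ 2 / 2) with hK
  refine ⟨K + |Real.log (p i)|, fun a z => ?_⟩
  set B : ℝ := (1 + |a| + ‖z‖) ^ 2 with hB
  have hB1 : 1 ≤ B := by
    have := abs_nonneg a
    have := norm_nonneg z
    nlinarith
  have hKB : ∀ j, logRatio x i j a z ≤ K * B := fun j => by
    refine (le_abs_self _).trans ((abs_logRatio_le i j a z).trans ?_)
    gcongr
    exact Finset.single_le_sum (f := fun j => ‖x j - x i‖ + ‖x j - x i‖ ^ 2 / 2)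
      (fun _ _ => by positivity) (Finset.mem_univ j)
  have hK0 : 0 ≤ K := Finset.sum_nonneg fun _ _ => by positivity
  have hup : Real.log (mixRatio p x i a z) ≤ K * B := by
    rw [Real.log_le_iff_le_exp (mixRatio_pos hp i a z)]
    calc mixRatio p x i a z ≤ ∑ j, p j * Real.exp (K * B) :=
          Finset.sum_le_sum fun j _ =>
            mul_le_mul_of_nonneg_left (Real.exp_le_exp.2 (hKB j)) (hp j).le
      _ = _ := by rw [← Finset.sum_mul, hp_sum, one_mul]
  have hlow : Real.log (p i) ≤ Real.log (mixRatio p x i a z) :=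
    Real.log_le_log (hp i) (weight_le_mixRatio hp i a z)
  have hl := abs_nonneg (Real.log (p i))
  have hl' := neg_abs_le (Real.log (p i))
  rw [infoDensity, abs_neg, abs_le]
  constructor <;> nlinarith [mul_nonneg hK0 (zero_le_one.trans hB1)]

lemma Tame.exists_bound (hp_sum : ∑ i, p i = 1) {f : ℝ → E → ℝ} (hf : Tame p x f) :
    ∃ C N, 0 ≤ C ∧ ∀ a z, |f a z| ≤ C * (1 + |a| + ‖z‖) ^ (N : ℕ) := by
  have base : ∀ (a : ℝ) (z : E), 1 ≤ 1 + |a| + ‖z‖ := fun a z => by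
    linarith [abs_nonneg a, norm_nonneg z]
  induction hf with
  | const c => exact ⟨|c|, 0, abs_nonneg c, fun a z => by simp⟩
  | scale => exact ⟨1, 1, zero_le_one, fun a z => by
      rw [pow_one]
      linarith [norm_nonneg z]⟩
  | lin v => exact ⟨‖v‖, 1, norm_nonneg v, fun a z => by
      refine (abs_real_inner_le_norm _ _).trans ?_
      gcongr
      rw [pow_one]
      linarith [abs_nonneg a]⟩
  | posterior i j => exact ⟨1, 0, zero_le_one, fun a z => by
      rw [abs_of_nonneg (posterior_nonneg hp i j a z)]
      simpa using posterior_le_one hp i j a z⟩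
  | infoDensity i =>
    obtain ⟨C, hC⟩ := abs_infoDensity_le hp (x := x) hp_sum i
    exact ⟨|C|, 2, abs_nonneg C, fun a z => (hC a z).trans (by gcongr; exact le_abs_self C)⟩
  | add _ _ h₁ h₂ =>
    obtain ⟨C₁, N₁, c₁, h₁⟩ := h₁
    obtain ⟨C₂, N₂, c₂, h₂⟩ := h₂
    refine ⟨C₁ + C₂, max N₁ N₂, by positivity, fun a z => (abs_add_le _ _).trans ?_⟩
    rw [add_mul]
    refine add_le_add ((h₁ a z).trans ?_) ((h₂ a z).trans ?_) <;> gcongr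
    · exact base a z
    · exact le_max_left _ _
    · exact base a z
    · exact le_max_right _ _
  | mul _ _ h₁ h₂ =>
    obtain ⟨C₁, N₁, c₁, h₁⟩ := h₁
    obtain ⟨C₂, N₂, c₂, h₂⟩ := h₂
    refine ⟨C₁ * C₂, N₁ + N₂, by positivity, fun a z => ?_⟩
    rw [abs_mul, pow_add, mul_mul_mul_comm]
    exact mul_le_mul (h₁ a z) (h₂ a z) (abs_nonneg _) ((abs_nonneg _).trans (h₁ a z))

/-- The posterior probability of a wrong component decays faster than any power of the scale. -/
lemma exists_posterior_mul_pow_le {i j : Fin k} (hx : x i ≠ x j) (M : ℕ) :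
    ∃ C, 0 ≤ C ∧ ∀ a z, 0 ≤ a → posterior p x i j a z * a ^ M ≤ C * (1 + ‖z‖) ^ M := by
  set δ : ℝ := ‖x j - x i‖
  have hδ : 0 < δ := norm_pos_iff.2 (sub_ne_zero.2 hx.symm)
  obtain ⟨C₀, hC₀, hexp⟩ : ∃ C₀ : ℝ, 0 ≤ C₀ ∧ ∀ a : ℝ, 0 ≤ a →
      Real.exp (-(a ^ 2 * δ ^ 2 / 4)) * a ^ M ≤ C₀ := by
    -- The factorial term comes from e^u ≥ u^M / M! with u = a²δ²/4, used for a ≥ 1; the summand 1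
    -- covers a ≤ 1.
    refine ⟨M.factorial / (δ ^ 2 / 4) ^ M + 1, by positivity, fun a ha => ?_⟩
    rcases le_total a 1 with h1 | h1
    · have h₁ : Real.exp (-(a ^ 2 * δ ^ 2 / 4)) ≤ 1 := Real.exp_le_one_iff.2 (by
        have : 0 ≤ a ^ 2 * δ ^ 2 / 4 := by positivity
        linarith)
      have h₂ : a ^ M ≤ 1 := pow_le_one₀ ha h1
      have h₃ : 0 ≤ (M.factorial : ℝ) / (δ ^ 2 / 4) ^ M := by positivity
      nlinarith [Real.exp_pos (-(a ^ 2 * δ ^ 2 / 4)), pow_nonneg ha M]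
    · have h₁ := Real.pow_div_factorial_le_exp (a ^ 2 * δ ^ 2 / 4) (by positivity) M
      have h₂ : a ^ M ≤ (a ^ 2) ^ M := by
        gcongr
        nlinarith
      have h₃ : (a ^ 2) ^ M ≤
          M.factorial / (δ ^ 2 / 4) ^ M * Real.exp (a ^ 2 * δ ^ 2 / 4) := by
        rw [div_le_iff₀ (by positivity)] at h₁
        rw [div_mul_eq_mul_div, le_div_iff₀ (by positivity), ← mul_pow, mul_comm (M.factorial : ℝ)]
        rwa [← mul_div_assoc]
      have h₄ := mul_le_mul_of_nonneg_left (h₂.trans h₃) (Real.exp_pos (-(a ^ 2 * δ ^ 2 / 4))).le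
      rw [mul_left_comm, ← Real.exp_add, neg_add_cancel, Real.exp_zero, mul_one] at h₄
      linarith
  refine ⟨p j / p i * C₀ + (4 / δ) ^ M, ?_, fun a z ha => ?_⟩
  · have := hp i
    have := hp j
    positivity
  have hz := norm_nonneg z
  have hq := posterior_nonneg hp (x := x) i j a z
  have hpij : 0 ≤ p j / p i := (div_pos (hp j) (hp i)).le
  have hone : 1 ≤ (1 + ‖z‖) ^ M := one_le_pow₀ (by linarith)
  -- For ‖z‖ ≤ aδ/4 the log-ratio is at most a²δ²/4 - a²δ²/2 = -a²δ²/4. Otherwise a ≤ 4‖z‖/δ, and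
  -- the power of a is charged to z while the posterior is bounded by 1.
  rcases le_total ‖z‖ (a * δ / 4) with h | h
  · have hφ : logRatio x i j a z ≤ -(a ^ 2 * δ ^ 2 / 4) := by
      have h₁ : inner ℝ (x j - x i) z ≤ δ * ‖z‖ := real_inner_le_norm _ _
      have h₂ : a * inner ℝ (x j - x i) z ≤ a * (δ * (a * δ / 4)) := by gcongr; exact h₁.trans (by gcongr)
      have h₃ : logRatio x i j a z = a * inner ℝ (x j - x i) z - a ^ 2 * δ ^ 2 / 2 := rfl
      rw [h₃]
      nlinarith
    have hle : posterior p x i j a z ≤ p j / p i * Real.exp (-(a ^ 2 * δ ^ 2 / 4)) := by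
      rw [posterior, div_mul_eq_mul_div]
      exact div_le_div₀ (mul_pos (hp j) (Real.exp_pos _)).le
        (mul_le_mul_of_nonneg_left (Real.exp_le_exp.2 hφ) (hp j).le) (hp i)
        (weight_le_mixRatio hp i a z)
    calc posterior p x i j a z * a ^ M
        ≤ p j / p i * Real.exp (-(a ^ 2 * δ ^ 2 / 4)) * a ^ M := by gcongr
      _ = p j / p i * (Real.exp (-(a ^ 2 * δ ^ 2 / 4)) * a ^ M) := by ring
      _ ≤ p j / p i * C₀ := by gcongr; exact hexp a ha
      _ ≤ p j / p i * C₀ + (4 / δ) ^ M := le_add_of_nonneg_right (by positivity)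
      _ ≤ _ := le_mul_of_one_le_right (by positivity) hone
  · have ha' : a ≤ 4 / δ * ‖z‖ := by
      rw [div_mul_eq_mul_div, le_div_iff₀ hδ]
      linarith
    calc posterior p x i j a z * a ^ M ≤ 1 * (4 / δ * ‖z‖) ^ M := by
          gcongr
          exact posterior_le_one hp i j a z
      _ = (4 / δ) ^ M * ‖z‖ ^ M := by rw [one_mul, mul_pow]
      _ ≤ (p j / p i * C₀ + (4 / δ) ^ M) * (1 + ‖z‖) ^ M := by
          gcongr
          · exact le_add_of_nonneg_left (by positivity)
          · linarith

/-- A decaying function tends to zero as the scale grows, dominated by a power of `1 + ‖z‖`. -/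
lemma Decaying.exists_bound (hp_sum : ∑ i, p i = 1) (hx : Function.Injective x)
    {f : ℝ → E → ℝ} (hf : Decaying p x f) :
    ∃ C N, 0 ≤ C ∧ ∀ a z, 1 ≤ a → a * |f a z| ≤ C * (1 + ‖z‖) ^ (N : ℕ) := by
  induction hf with
  | zero => exact ⟨0, 0, le_rfl, fun a z _ => by simp⟩
  | @mul i j f hij hf =>
    obtain ⟨C, N, hC, hb⟩ := hf.exists_bound hp hp_sum
    -- N powers absorb the growth of the tame factor; the extra one pays for the factor a, which
    -- later yields decay like 1/a.
    obtain ⟨D, hD, hq⟩ := exists_posterior_mul_pow_le hp (hx.ne hij) (N + 1)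
    refine ⟨C * 2 ^ N * D, N + 1 + N, by positivity, fun a z ha => ?_⟩
    have hz := norm_nonneg z
    have hq0 := posterior_nonneg hp (x := x) i j a z
    have h₁ : (1 + |a| + ‖z‖) ^ N ≤ 2 ^ N * a ^ N * (1 + ‖z‖) ^ N := by
      rw [← mul_pow, ← mul_pow, abs_of_nonneg (zero_le_one.trans ha)]
      gcongr
      nlinarith
    rw [abs_mul, abs_of_nonneg hq0]
    calc a * (posterior p x i j a z * |f a z|)
        ≤ a * (posterior p x i j a z * (C * (2 ^ N * a ^ N * (1 + ‖z‖) ^ N))) := by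
          gcongr
          exact (hb a z).trans (by gcongr)
      _ = C * 2 ^ N * (posterior p x i j a z * a ^ (N + 1)) * (1 + ‖z‖) ^ N := by ring
      _ ≤ C * 2 ^ N * (D * (1 + ‖z‖) ^ (N + 1)) * (1 + ‖z‖) ^ N := by
          have := hq a z (zero_le_one.trans ha)
          gcongr
      _ = _ := by ring
  | add _ _ h₁ h₂ =>
    obtain ⟨C₁, N₁, c₁, h₁⟩ := h₁
    obtain ⟨C₂, N₂, c₂, h₂⟩ := h₂
    refine ⟨C₁ + C₂, max N₁ N₂, by positivity, fun a z ha => ?_⟩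
    have hone : 1 ≤ 1 + ‖z‖ := by linarith [norm_nonneg z]
    refine (mul_le_mul_of_nonneg_left (abs_add_le _ _) (zero_le_one.trans ha)).trans ?_
    rw [mul_add, add_mul]
    refine add_le_add ((h₁ a z ha).trans ?_) ((h₂ a z ha).trans ?_)
    · gcongr
      exact le_max_left _ _
    · gcongr
      exact le_max_right _ _

end Bounds

/-! ### Gaussian expectations of tame and decaying functions. -/

section Expectation

variable [FiniteDimensional ℝ E] [MeasurableSpace E] [BorelSpace E]

lemma integrable_one_add_norm_pow (r : ℝ) (hr : 0 ≤ r) (N : ℕ) :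
    Integrable (fun z : E => (1 + r + ‖z‖) ^ N) (stdGaussian E) := by
  have h := IsGaussian.memLp_id (stdGaussian E) N (by simp)
  have h₂ : MemLp (fun z : E => 1 + r + ‖z‖) N (stdGaussian E) := (memLp_const (1 + r)).add h.norm
  refine h₂.integrable_norm_pow'.congr (ae_of_all _ fun z => ?_)
  simp only
  rw [Real.norm_of_nonneg (by positivity)]

variable {p : Fin k → ℝ} {x : Fin k → E} (hp : ∀ i, 0 < p i) (hp_sum : ∑ i, p i = 1)
include hp hp_sum

lemma Tame.integrable {f : ℝ → E → ℝ} (hf : Tame p x f) (a : ℝ) :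
    Integrable (f a) (stdGaussian E) := by
  obtain ⟨C, N, -, h⟩ := hf.exists_bound hp hp_sum
  exact ((integrable_one_add_norm_pow |a| (abs_nonneg a) N).const_mul C).mono'
    (hf.continuous hp a).aestronglyMeasurable (ae_of_all _ fun z => h a z)

lemma Tame.hasDerivAt_integral {f g : ℝ → E → ℝ} (hf : Tame p x f) (hg : Tame p x g)
    (h : ∀ a z, HasDerivAt (fun a => f a z) (g a z) a) (a : ℝ) :
    HasDerivAt (fun a => ∫ z, f a z ∂stdGaussian E) (∫ z, g a z ∂stdGaussian E) a := by
  obtain ⟨C, N, hC, hb⟩ := hg.exists_bound hp hp_sum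
  -- On the unit ball around a, |b| ≤ |a| + 1 gives a dominating function independent of b.
  refine (hasDerivAt_integral_of_dominated_loc_of_deriv_le
    (bound := fun z => C * (1 + (|a| + 1) + ‖z‖) ^ N) (Metric.ball_mem_nhds a one_pos)
    (Eventually.of_forall fun b => (hf.continuous hp b).aestronglyMeasurable)
    (hf.integrable hp hp_sum a) (hg.continuous hp a).aestronglyMeasurable
    (ae_of_all _ fun z b hbmem => (hb b z).trans ?_)
    ((integrable_one_add_norm_pow _ (by positivity) N).const_mul C)
    (ae_of_all _ fun z b _ => h b z)).2
  have : |b| ≤ |a| + 1 := by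
    have h₁ : |b - a| < 1 := hbmem
    have h₂ := abs_sub_abs_le_abs_sub b a
    linarith
  gcongr

lemma Decaying.tendsto_integral (hx : Function.Injective x) {f : ℝ → E → ℝ}
    (hf : Decaying p x f) :
    Tendsto (fun a => ∫ z, f a z ∂stdGaussian E) atTop (𝓝 0) := by
  obtain ⟨C, N, hC, hb⟩ := hf.exists_bound hp hp_sum hx
  have hlim : Tendsto (fun a : ℝ => (∫ z : E, C * (1 + ‖z‖) ^ N ∂stdGaussian E) * a⁻¹)
      atTop (𝓝 0) := by
    simpa using tendsto_inv_atTop_zero.const_mul (∫ z : E, C * (1 + ‖z‖) ^ N ∂stdGaussian E)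
  refine squeeze_zero_norm' ?_ hlim
  filter_upwards [eventually_ge_atTop 1] with a ha
  rw [← integral_mul_const]
  refine norm_integral_le_of_norm_le (Integrable.mul_const ?_ _) (ae_of_all _ fun z => ?_)
  · simpa using (integrable_one_add_norm_pow (E := E) 0 le_rfl N).const_mul C
  · rw [← div_eq_mul_inv, le_div_iff₀ (zero_lt_one.trans_le ha), mul_comm]
    exact hb a z ha

end Expectation

end PointMixture

/-! ### Finiteness and invariance of mutual information. -/

section MutualInfo

variable {Ω E F : Type*} [MeasurableSpace Ω] [MeasurableSpace E] [MeasurableSpace F]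

/-- The density takes values in [0, C], where the continuous function `klFun` is bounded. -/
lemma InformationTheory.klDiv_ne_top_of_le_smul {μ ν : Measure E} [IsFiniteMeasure μ]
    [IsFiniteMeasure ν] {C : ℝ≥0∞} (hC : C ≠ ∞) (h : μ ≤ C • ν) :
    InformationTheory.klDiv μ ν ≠ ∞ := by
  have hac : μ ≪ ν := (Measure.absolutelyContinuous_of_le h).trans
    (Measure.smul_absolutelyContinuous)
  have hle : μ.rnDeriv ν ≤ᵐ[ν] fun _ => C := by
    refine ae_le_of_forall_setLIntegral_le_of_sigmaFinite (Measure.measurable_rnDeriv μ ν)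
      fun s hs _ => ?_
    rw [setLIntegral_const]
    exact (Measure.setLIntegral_rnDeriv_le s).trans (h s)
  obtain ⟨K, hK⟩ := (isCompact_Icc (a := (0 : ℝ)) (b := C.toReal)).exists_bound_of_continuousOn
    InformationTheory.continuous_klFun.continuousOn
  rw [InformationTheory.klDiv_eq_lintegral_klFun_of_ac hac]
  refine ((lintegral_mono_ae (g := fun _ => ENNReal.ofReal K) ?_).trans_lt ?_).ne
  · filter_upwards [hle] with a ha
    exact ENNReal.ofReal_le_ofReal ((le_abs_self _).trans
      (hK _ ⟨ENNReal.toReal_nonneg, ENNReal.toReal_mono hC ha⟩))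
  · rw [lintegral_const]
    exact ENNReal.mul_lt_top ENNReal.ofReal_lt_top (measure_lt_top ν _)

/-- The mutual information with a variable of finite support is finite. -/
lemma mutualInfo_ne_top_of_map_eq_sum_dirac [MeasurableSingletonClass E] {P : Measure Ω}
    [IsProbabilityMeasure P] {k : ℕ} {p : Fin k → ℝ} (hp : ∀ i, 0 < p i) {x : Fin k → E}
    {X : Ω → E} {Y : Ω → F} (hX : Measurable X) (hY : Measurable Y)
    (hlaw : P.map X = ∑ i, ENNReal.ofReal (p i) • Measure.dirac (x i)) :
    mutualInfo X Y P ≠ ∞ := by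
  have := Measure.isProbabilityMeasure_map (μ := P) hX.aemeasurable
  have := Measure.isProbabilityMeasure_map (μ := P) hY.aemeasurable
  -- On the slice X = x i the joint law has mass at most P(Y ∈ A), against p i · P(Y ∈ A) for the
  -- product; the sum dominates every 1 / p i.
  refine InformationTheory.klDiv_ne_top_of_le_smul (C := ∑ i, (ENNReal.ofReal (p i))⁻¹) ?_ ?_
  · simp [ENNReal.sum_eq_top, hp]
  refine Measure.le_iff.2 fun s hs => ?_
  have hfin : ∀ᵐ ω ∂P, ∃ i, X ω = x i := by
    have h : ∀ᵐ e ∂P.map X, e ∈ Set.range x := by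
      rw [hlaw, ae_iff, Measure.coe_finsetSum, Finset.sum_apply]
      refine Finset.sum_eq_zero fun i _ => ?_
      rw [Measure.smul_apply, Measure.dirac_apply]
      simp
    filter_upwards [ae_of_ae_map hX.aemeasurable h] with ω ⟨i, hi⟩ using ⟨i, hi.symm⟩
  have hsec : ∀ i, MeasurableSet (Prod.mk (x i) ⁻¹' s) := fun i => measurable_prodMk_left hs
  have hprod : ((P.map X).prod (P.map Y)) s
      = ∑ i, ENNReal.ofReal (p i) * P (Y ⁻¹' (Prod.mk (x i) ⁻¹' s)) := by
    rw [Measure.prod_apply hs, hlaw, lintegral_finsetSum_measure]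
    refine Finset.sum_congr rfl fun i _ => ?_
    rw [lintegral_smul_measure, lintegral_dirac, Measure.map_apply hY (hsec i), smul_eq_mul]
  rw [Measure.map_apply (hX.prodMk hY) hs, Measure.smul_apply, hprod, smul_eq_mul]
  calc P ((fun ω => (X ω, Y ω)) ⁻¹' s)
      ≤ P (⋃ i, Y ⁻¹' (Prod.mk (x i) ⁻¹' s)) := by
        refine measure_mono_ae ?_
        filter_upwards [hfin] with ω ⟨i, hi⟩ hω
        refine Set.mem_iUnion.2 ⟨i, ?_⟩
        change (X ω, Y ω) ∈ s at hω
        rwa [hi] at hω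
    _ ≤ ∑ i, P (Y ⁻¹' (Prod.mk (x i) ⁻¹' s)) := measure_iUnion_fintype_le _ _
    _ = ∑ i, (ENNReal.ofReal (p i))⁻¹ *
          (ENNReal.ofReal (p i) * P (Y ⁻¹' (Prod.mk (x i) ⁻¹' s))) := by
        refine Finset.sum_congr rfl fun i _ => ?_
        rw [← mul_assoc, ENNReal.inv_mul_cancel (by simp [hp i]) ENNReal.ofReal_ne_top, one_mul]
    _ ≤ _ := by
        rw [Finset.mul_sum]
        refine Finset.sum_le_sum fun i _ => ?_
        gcongr
        exact Finset.single_le_sum (f := fun i => (ENNReal.ofReal (p i))⁻¹)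
          (fun _ _ => zero_le) (Finset.mem_univ i)

/-- Written through the joint law alone, mutual information can be transported by one pushforward.
-/
lemma mutualInfo_eq_klDiv_fst_snd {P : Measure Ω} {X : Ω → E} {Y : Ω → F} (hX : Measurable X)
    (hY : Measurable Y) : mutualInfo X Y P = InformationTheory.klDiv (P.map fun ω => (X ω, Y ω))
      ((P.map fun ω => (X ω, Y ω)).fst.prod (P.map fun ω => (X ω, Y ω)).snd) := by
  rw [Measure.fst_map_prodMk hY, Measure.snd_map_prodMk hX, mutualInfo]

/-- The mutual information is invariant under measurable equivalences of the second variable. -/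
lemma klDiv_fst_snd_map_prodMap (J : Measure (E × F)) [IsFiniteMeasure J] (e : F ≃ᵐ F) :
    InformationTheory.klDiv (J.map (Prod.map id e))
      ((J.map (Prod.map id e)).fst.prod (J.map (Prod.map id e)).snd) =
    InformationTheory.klDiv J (J.fst.prod J.snd) := by
  have he : Measurable (Prod.map id e : E × F → E × F) := measurable_id.prodMap e.measurable
  have he' : Measurable (Prod.map id e.symm : E × F → E × F) :=
    measurable_id.prodMap e.symm.measurable
  have hfst : (J.map (Prod.map id e)).fst = J.fst := by
    rw [Measure.fst, Measure.map_map measurable_fst he]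
    rfl
  have hsnd : (J.map (Prod.map id e)).snd = J.snd.map e := by
    rw [Measure.snd, Measure.snd, Measure.map_map measurable_snd he,
      Measure.map_map e.measurable measurable_snd]
    rfl
  have hprod : J.fst.prod (J.snd.map e) = (J.fst.prod J.snd).map (Prod.map id e) := by
    conv_lhs => rw [← Measure.map_id (μ := J.fst)]
    exact Measure.map_prod_map _ _ measurable_id e.measurable
  have hinv : ∀ M : Measure (E × F), (M.map (Prod.map id e)).map (Prod.map id e.symm) = M :=
    fun M => by
      rw [Measure.map_map he' he, Prod.map_comp_map, e.symm_comp_self, Function.comp_id,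
        Prod.map_id, Measure.map_id]
  have : IsFiniteMeasure (J.map (Prod.map id e)) := inferInstance
  rw [hfst, hsnd, hprod]
  -- Data processing is applied to the map and then to its inverse.
  refine le_antisymm (InformationTheory.klDiv_map_le _ _ he) ?_
  conv_lhs => rw [← hinv J]
  have h := InformationTheory.klDiv_map_le (J.map (Prod.map id e))
    ((J.fst.prod J.snd).map (Prod.map id e)) he'
  rw [hinv, hinv (J.fst.prod J.snd)] at h
  rwa [hinv]

end MutualInfo

/-! ### Gaussian densities and the Cameron–Martin formula. -/

/-- Density of the shifted standard Gaussian measure with respect to the standard one. -/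
noncomputable def gaussianShiftDensity {E : Type*} [NormedAddCommGroup E] [InnerProductSpace ℝ E]
    (m z : E) : ℝ :=
  Real.exp (inner ℝ m z - ‖m‖ ^ 2 / 2)

lemma gaussianShiftDensity_pos {E : Type*} [NormedAddCommGroup E] [InnerProductSpace ℝ E]
    (m z : E) : 0 < gaussianShiftDensity m z :=
  Real.exp_pos _

section GaussianShift

variable {E : Type*} [NormedAddCommGroup E] [InnerProductSpace ℝ E] [FiniteDimensional ℝ E]
  [MeasurableSpace E] [BorelSpace E]

/-- Density of the standard Gaussian measure with respect to the Lebesgue measure. -/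
lemma stdGaussian_eq_withDensity : ∃ C : ℝ, 0 ≤ C ∧ stdGaussian E =
    volume.withDensity fun z => ENNReal.ofReal (C * Real.exp (-‖z‖ ^ 2 / 2)) := by
  set d : ℝ := (2 * Real.pi) ^ (Module.finrank ℝ E / 2 : ℝ) with hd
  have hd0 : 0 < d := by positivity
  refine ⟨d⁻¹, by positivity, ?_⟩
  have hint : Integrable (fun z : E => d⁻¹ * Real.exp (-‖z‖ ^ 2 / 2)) := by
    have h := GaussianFourier.integrable_cexp_neg_mul_sq_norm_add (V := E) (b := 1 / 2)
      (by norm_num) 0 0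
    refine (h.re.const_mul d⁻¹).congr (ae_of_all _ fun z => ?_)
    simp only [RCLike.re_to_complex, zero_mul, add_zero]
    congr 1
    rw [show (-(1 / 2 : ℂ) * (‖z‖ : ℂ) ^ 2) = ((-‖z‖ ^ 2 / 2 : ℝ) : ℂ) by push_cast; ring,
      Complex.exp_ofReal_re]
  have : IsFiniteMeasure (volume.withDensity
      fun z : E => ENNReal.ofReal (d⁻¹ * Real.exp (-‖z‖ ^ 2 / 2))) :=
    isFiniteMeasure_withDensity_ofReal hint.2
  refine Measure.ext_of_charFun (funext fun t => ?_)
  rw [charFun_stdGaussian, charFun_apply, integral_withDensity_eq_integral_toReal_smul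
    (by fun_prop) (ae_of_all _ fun _ => ENNReal.ofReal_lt_top)]
  have h := GaussianFourier.integral_cexp_neg_mul_sq_norm_add (V := E) (b := 1 / 2)
    (by norm_num) Complex.I t
  have hfun : ∀ z : E, (ENNReal.ofReal (d⁻¹ * Real.exp (-‖z‖ ^ 2 / 2))).toReal •
      Complex.exp (inner ℝ z t * Complex.I) =
      ((d⁻¹ : ℝ) : ℂ) * Complex.exp (-(1 / 2) * ‖z‖ ^ 2 + Complex.I * inner ℝ t z) := fun z => by
    rw [ENNReal.toReal_ofReal (by positivity), Complex.real_smul, Complex.ofReal_mul, mul_assoc,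
      Complex.ofReal_exp, ← Complex.exp_add, real_inner_comm]
    congr 2
    push_cast
    ring
  simp_rw [hfun]
  rw [integral_const_mul, h]
  have hpow : ((Real.pi : ℂ) / (1 / 2)) ^ (Module.finrank ℝ E / 2 : ℂ) = (d : ℂ) := by
    rw [hd, Complex.ofReal_cpow (by positivity)]
    push_cast
    congr 1
    ring
  rw [hpow, ← mul_assoc, ← Complex.ofReal_mul, inv_mul_cancel₀ hd0.ne', Complex.ofReal_one, one_mul]
  congr 1
  rw [Complex.I_sq]
  ring

lemma measurable_gaussianShiftDensity (m : E) : Measurable (gaussianShiftDensity m) := by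
  unfold gaussianShiftDensity
  fun_prop

/-- The Cameron–Martin formula in finite dimension. -/
lemma lintegral_stdGaussian_add (m : E) {g : E → ℝ≥0∞} (hg : Measurable g) :
    ∫⁻ z, g (m + z) ∂stdGaussian E =
      ∫⁻ z, ENNReal.ofReal (gaussianShiftDensity m z) * g z ∂stdGaussian E := by
  obtain ⟨C, hC, h⟩ := stdGaussian_eq_withDensity (E := E)
  have hm : Measurable fun z : E => ENNReal.ofReal (C * Real.exp (-‖z‖ ^ 2 / 2)) := by fun_prop
  -- After translating the Lebesgue integral by m, expanding ‖z - m‖² produces the shift density.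
  rw [h, lintegral_withDensity_eq_lintegral_mul _ hm (by fun_prop),
    lintegral_withDensity_eq_lintegral_mul _ hm
      (show Measurable fun z => ENNReal.ofReal (gaussianShiftDensity m z) * g z from
        (measurable_gaussianShiftDensity m).ennreal_ofReal.mul hg),
    ← lintegral_sub_right_eq_self _ m]
  refine lintegral_congr fun z => ?_
  simp only [Pi.mul_apply]
  rw [add_sub_cancel, ← mul_assoc, ← ENNReal.ofReal_mul (by positivity), gaussianShiftDensity,
    mul_assoc, ← Real.exp_add, norm_sub_sq_real, real_inner_comm]
  congr 4
  ring

end GaussianShift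

/-! ### Mutual information of the Gaussian channel with finite input. -/

namespace PointMixture

variable {E : Type*} [NormedAddCommGroup E] [InnerProductSpace ℝ E] {k : ℕ}

/-- Density of `channel p x a` with respect to the product of its marginals. -/
noncomputable def channelDensity (p : Fin k → ℝ) (x : Fin k → E) (a : ℝ) (y : E × E) : ℝ :=
  gaussianShiftDensity (a • y.1) y.2 / ∑ j, p j * gaussianShiftDensity (a • x j) y.2

variable {p : Fin k → ℝ} {x : Fin k → E}

/-- The index i serves only to show that the sum is nonempty. -/
lemma sum_gaussianShiftDensity_pos (hp : ∀ i, 0 < p i) (i : Fin k) (a : ℝ) (z : E) :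
    0 < ∑ j, p j * gaussianShiftDensity (a • x j) z :=
  Finset.sum_pos (fun j _ => mul_pos (hp j) (gaussianShiftDensity_pos _ _)) ⟨i, Finset.mem_univ i⟩

/-- At the observation a • x i + z, the quotient of the j-th and i-th shift densities is exp of
`logRatio x i j a z`. -/
lemma log_channelDensity (a : ℝ) (i : Fin k) (z : E) :
    Real.log (channelDensity p x a (x i, a • x i + z)) = infoDensity p x i a z := by
  rw [infoDensity, ← Real.log_inv]
  congr 1
  rw [channelDensity, mixRatio, ← inv_div, div_eq_mul_inv, Finset.sum_mul]
  congr 1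
  refine Finset.sum_congr rfl fun j _ => ?_
  rw [mul_assoc, ← div_eq_mul_inv, gaussianShiftDensity, gaussianShiftDensity, ← Real.exp_sub,
    logRatio]
  congr 2
  simp only [norm_sub_sq_real, norm_smul, mul_pow, inner_add_right, inner_sub_left,
    inner_smul_left, inner_smul_right, real_inner_self_eq_norm_sq, Real.norm_eq_abs, sq_abs,
    RCLike.conj_to_real]
  ring

variable [FiniteDimensional ℝ E] [MeasurableSpace E] [BorelSpace E]

/-- Joint law of `X` and `a • X + Z`, where `X` has law `∑ i, p i • dirac (x i)` and `Z` is an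
independent standard Gaussian vector. -/
noncomputable def channel (p : Fin k → ℝ) (x : Fin k → E) (a : ℝ) : Measure (E × E) :=
  ∑ i, ENNReal.ofReal (p i) • (stdGaussian E).map fun z => (x i, a • x i + z)

lemma lintegral_channel (a : ℝ) {g : E × E → ℝ≥0∞} (hg : Measurable g) :
    ∫⁻ y, g y ∂channel p x a =
      ∑ i, ENNReal.ofReal (p i) * ∫⁻ z, g (x i, a • x i + z) ∂stdGaussian E := by
  rw [channel, lintegral_finsetSum_measure]
  refine Finset.sum_congr rfl fun i _ => ?_
  rw [lintegral_smul_measure, lintegral_map hg (by fun_prop), smul_eq_mul]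

lemma map_prod_stdGaussian_eq_channel (a : ℝ) :
    ((∑ i, ENNReal.ofReal (p i) • Measure.dirac (x i)).prod (stdGaussian E)).map
      (fun y => (y.1, a • y.1 + y.2)) = channel p x a := by
  refine Measure.ext_of_lintegral _ fun g hg => ?_
  rw [lintegral_channel a hg, lintegral_map hg (by fun_prop),
    lintegral_prod _ (by fun_prop), lintegral_finsetSum_measure]
  refine Finset.sum_congr rfl fun i _ => ?_
  rw [lintegral_smul_measure, lintegral_dirac, smul_eq_mul]

lemma lintegral_channel_fst (a : ℝ) {g : E → ℝ≥0∞} (hg : Measurable g) :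
    ∫⁻ y, g y ∂(channel p x a).fst = ∑ i, ENNReal.ofReal (p i) * g (x i) := by
  rw [Measure.fst, lintegral_map hg measurable_fst, lintegral_channel a (by fun_prop)]
  simp

lemma lintegral_channel_snd (a : ℝ) {g : E → ℝ≥0∞} (hg : Measurable g) :
    ∫⁻ y, g y ∂(channel p x a).snd =
      ∑ i, ENNReal.ofReal (p i) * ∫⁻ z, g (a • x i + z) ∂stdGaussian E := by
  rw [Measure.snd, lintegral_map hg measurable_snd, lintegral_channel a (by fun_prop)]

lemma measurable_channelDensity (a : ℝ) : Measurable (channelDensity p x a) := by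
  unfold channelDensity gaussianShiftDensity
  fun_prop

lemma isFiniteMeasure_channel (a : ℝ) : IsFiniteMeasure (channel p x a) := by
  refine ⟨?_⟩
  rw [← setLIntegral_one, Measure.restrict_univ, lintegral_channel a measurable_const]
  simp

lemma isProbabilityMeasure_channel (hp : ∀ i, 0 < p i) (hp_sum : ∑ i, p i = 1) (a : ℝ) :
    IsProbabilityMeasure (channel p x a) := by
  refine ⟨?_⟩
  rw [← setLIntegral_one, Measure.restrict_univ, lintegral_channel a measurable_const]
  simp [← ENNReal.ofReal_sum_of_nonneg fun i _ => (hp i).le, hp_sum]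

/-- By Cameron–Martin every component has a density against the same standard Gaussian. The density
of the second marginal is then the denominator of `channelDensity` and cancels it. -/
lemma channel_eq_withDensity (hp : ∀ i, 0 < p i) (a : ℝ) : channel p x a =
    ((channel p x a).fst.prod (channel p x a).snd).withDensity
      fun y => ENNReal.ofReal (channelDensity p x a y) := by
  have := isFiniteMeasure_channel (p := p) (x := x) a
  have hρ : Measurable fun y => ENNReal.ofReal (channelDensity p x a y) :=
    (measurable_channelDensity a).ennreal_ofReal
  refine Measure.ext_of_lintegral _ fun g hg => ?_
  have hρg : Measurable fun y => ENNReal.ofReal (channelDensity p x a y) * g y := hρ.mul hg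
  rw [lintegral_channel a hg, lintegral_withDensity_eq_lintegral_mul _ hρ hg]
  simp only [Pi.mul_apply]
  rw [lintegral_prod _ hρg.aemeasurable, lintegral_channel_fst a hρg.lintegral_prod_right']
  refine Finset.sum_congr rfl fun i _ => ?_
  congr 1
  have hgi : Measurable fun z => g (x i, z) := hg.comp measurable_prodMk_left
  have hρi : Measurable fun z => ENNReal.ofReal (channelDensity p x a (x i, z)) * g (x i, z) :=
    hρg.comp measurable_prodMk_left
  have hd : ∀ j, Measurable fun z => ENNReal.ofReal (gaussianShiftDensity (a • x j) z) :=
    fun j => (measurable_gaussianShiftDensity _).ennreal_ofReal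
  rw [lintegral_channel_snd a hρi, lintegral_stdGaussian_add (a • x i) hgi]
  simp_rw [lintegral_stdGaussian_add _ hρi]
  have hdρ : ∀ j, Measurable fun z => ENNReal.ofReal (gaussianShiftDensity (a • x j) z) *
      (ENNReal.ofReal (channelDensity p x a (x i, z)) * g (x i, z)) := fun j => (hd j).mul hρi
  have hconst : ∀ j, ENNReal.ofReal (p j) *
      ∫⁻ z, ENNReal.ofReal (gaussianShiftDensity (a • x j) z) *
        (ENNReal.ofReal (channelDensity p x a (x i, z)) * g (x i, z)) ∂stdGaussian E =
      ∫⁻ z, ENNReal.ofReal (p j) * (ENNReal.ofReal (gaussianShiftDensity (a • x j) z) *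
        (ENNReal.ofReal (channelDensity p x a (x i, z)) * g (x i, z))) ∂stdGaussian E :=
    fun j => (lintegral_const_mul _ (hdρ j)).symm
  simp_rw [hconst]
  rw [← lintegral_finsetSum _ fun j _ => (hdρ j).const_mul _]
  refine lintegral_congr fun z => ?_
  have hpos := sum_gaussianShiftDensity_pos (x := x) hp i a z
  simp_rw [← mul_assoc]
  rw [← Finset.sum_mul]
  congr 1
  rw [← Finset.sum_mul]
  have hsum : ∑ j, ENNReal.ofReal (p j) * ENNReal.ofReal (gaussianShiftDensity (a • x j) z) =
      ENNReal.ofReal (∑ j, p j * gaussianShiftDensity (a • x j) z) := by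
    rw [ENNReal.ofReal_sum_of_nonneg
      fun j _ => (mul_pos (hp j) (gaussianShiftDensity_pos _ _)).le]
    exact Finset.sum_congr rfl fun j _ => (ENNReal.ofReal_mul (hp j).le).symm
  rw [hsum, ← ENNReal.ofReal_mul hpos.le, channelDensity, mul_div_cancel₀ _ hpos.ne']

/-- The mutual information of `X` and `a • X + Z`. -/
lemma toReal_klDiv_channel (hp : ∀ i, 0 < p i) (hp_sum : ∑ i, p i = 1) (a : ℝ) :
    (InformationTheory.klDiv (channel p x a)
      ((channel p x a).fst.prod (channel p x a).snd)).toReal =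
    ∫ z, ∑ i, p i * infoDensity p x i a z ∂stdGaussian E := by
  have := isProbabilityMeasure_channel (x := x) hp hp_sum a
  have hw := channel_eq_withDensity (x := x) hp a
  set Q := (channel p x a).fst.prod (channel p x a).snd with hQ
  have hac : channel p x a ≪ Q := by
    rw [hw]
    exact withDensity_absolutelyContinuous _ _
  -- Both measures have mass one, so the divergence is the plain integral of the log-likelihood
  -- ratio.
  rw [InformationTheory.toReal_klDiv_of_measure_eq hac (by simp [hQ])]
  have hllr : llr (channel p x a) Q =ᵐ[channel p x a]
      fun y => Real.log (channelDensity p x a y) := by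
    have h : (channel p x a).rnDeriv Q =ᵐ[Q] fun y => ENNReal.ofReal (channelDensity p x a y) := by
      conv_lhs => rw [hw]
      exact Measure.rnDeriv_withDensity _ (measurable_channelDensity a).ennreal_ofReal
    filter_upwards [hac.ae_le h] with y hy
    rw [llr, hy, ENNReal.toReal_ofReal]
    refine div_nonneg (gaussianShiftDensity_pos _ _).le (Finset.sum_nonneg fun j _ => ?_)
    exact (mul_pos (hp j) (gaussianShiftDensity_pos _ _)).le
  rw [integral_congr_ae hllr]
  have hmeas : Measurable fun y => Real.log (channelDensity p x a y) :=
    (measurable_channelDensity a).log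
  have hshift : ∀ i, Measurable fun z : E => (x i, a • x i + z) := fun i => by fun_prop
  have hint : ∀ i, Integrable (infoDensity p x i a) (stdGaussian E) := fun i =>
    (Tame.infoDensity i).integrable hp hp_sum a
  conv_lhs => rw [channel]
  rw [integral_finsetSum_measure, integral_finsetSum _ fun i _ => (hint i).const_mul _]
  · refine Finset.sum_congr rfl fun i _ => ?_
    rw [integral_smul_measure, integral_map (hshift i).aemeasurable hmeas.aestronglyMeasurable,
      ENNReal.toReal_ofReal (hp i).le, integral_const_mul, smul_eq_mul]
    simp_rw [log_channelDensity]
  · intro i _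
    refine Integrable.smul_measure ?_ ENNReal.ofReal_ne_top
    rw [integrable_map_measure hmeas.aestronglyMeasurable (hshift i).aemeasurable]
    refine (hint i).congr (ae_of_all _ fun z => ?_)
    exact (log_channelDensity a i z).symm

/-- Mutual information of a finite mixture and its noisy observation. -/
lemma toReal_mutualInfo {Ω : Type*} [MeasurableSpace Ω] {P : Measure Ω} [IsProbabilityMeasure P]
    (hp : ∀ i, 0 < p i) (hp_sum : ∑ i, p i = 1) {X Y : Ω → E} (hX : Measurable X)
    (hY : Measurable Y) (hlaw : P.map X = ∑ i, ENNReal.ofReal (p i) • Measure.dirac (x i))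
    {a σ : ℝ} (hσ : σ ≠ 0)
    (hjoint : P.map (fun ω => (X ω, Y ω)) =
      ((P.map X).prod (stdGaussian E)).map fun y => (y.1, σ • (a • y.1 + y.2))) :
    (mutualInfo X Y P).toReal = ∫ z, ∑ i, p i * infoDensity p x i a z ∂stdGaussian E := by
  have := isFiniteMeasure_channel (p := p) (x := x) a
  have hmap : P.map (fun ω => (X ω, Y ω)) = (channel p x a).map
      (Prod.map id (MeasurableEquiv.smul₀ σ hσ)) := by
    rw [hjoint, hlaw, ← map_prod_stdGaussian_eq_channel, Measure.map_map (by fun_prop)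
      (by fun_prop)]
    rfl
  rw [mutualInfo_eq_klDiv_fst_snd hX hY, hmap, klDiv_fst_snd_map_prodMap,
    toReal_klDiv_channel hp hp_sum]

end PointMixture

/-! ### Riemann–Stieltjes sums along a continuous path. -/

section RiemannStieltjes

variable {F : Type*} [NormedAddCommGroup F] [NormedSpace ℝ F] [CompleteSpace F]

/-- Riemann–Stieltjes sums of a `C¹` integrand against a continuous integrator converge to the
value given by integration by parts. -/
lemma tendsto_sum_smul_sub {f : ℝ → F} (hf : Continuous f) {g g' : ℝ → ℝ}
    (hg : ∀ s, HasDerivAt g (g' s) s) (hg' : Continuous g') {t : ℝ} (ht : 0 ≤ t) :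
    Tendsto (fun N : ℕ => ∑ i ∈ Finset.range (N + 1), g (i * (t / (N + 1))) •
        (f ((i + 1) * (t / (N + 1))) - f (i * (t / (N + 1))))) atTop
      (𝓝 (g t • f t - g 0 • f 0 - ∫ s in (0 : ℝ)..t, g' s • f s)) := by
  obtain ⟨K, hK⟩ := (isCompact_Icc (a := 0) (b := t)).exists_bound_of_continuousOn
    hg'.continuousOn
  have hK0 : 0 ≤ K := (norm_nonneg _).trans (hK 0 ⟨le_rfl, ht⟩)
  have hunif := (isCompact_Icc (a := 0) (b := t)).uniformContinuousOn_of_continuous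
    hf.continuousOn
  rw [Metric.uniformContinuousOn_iff] at hunif
  rw [Metric.tendsto_atTop]
  intro ε hε
  -- The total error will be K t η; the added 1 keeps the denominator positive and the final
  -- inequality strict.
  set η : ℝ := ε / (K * t + 1) with hη
  have hη0 : 0 < η := by positivity
  obtain ⟨δ, hδ, hfδ⟩ := hunif η hη0
  obtain ⟨N₀, hN₀⟩ := exists_nat_gt (t / δ)
  refine ⟨N₀, fun N hN => ?_⟩
  have hM : (0 : ℝ) < N + 1 := by positivity
  set h : ℝ := t / (N + 1) with hh
  have hh0 : 0 ≤ h := by positivity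
  have hhδ : h < δ := by
    rw [hh, div_lt_iff₀ hM, mul_comm, ← div_lt_iff₀ hδ]
    have : (N₀ : ℝ) ≤ N := by exact_mod_cast hN
    linarith
  set s : ℕ → ℝ := fun i => i * h with hs
  have hs1 : ∀ i, s (i + 1) = (i + 1) * h := fun i => by simp [hs]
  have hsle : ∀ i, s i ≤ s (i + 1) := fun i => by
    rw [hs1]
    simp only [hs]
    nlinarith
  have hsN : s (N + 1) = t := by
    simp only [hs, hh]
    push_cast
    field_simp
  have hs0 : s 0 = 0 := by simp [hs]
  have hsmem : ∀ i ∈ Finset.range (N + 1), 0 ≤ s i ∧ s (i + 1) ≤ t := fun i hi => by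
    refine ⟨mul_nonneg (Nat.cast_nonneg i) hh0, hsN ▸ ?_⟩
    have : ((i + 1 : ℕ) : ℝ) ≤ (N + 1 : ℕ) := by exact_mod_cast Finset.mem_range.1 hi
    exact mul_le_mul_of_nonneg_right this hh0
  have hgf : Continuous fun r => g' r • f r := hg'.smul hf
  -- Summation by parts: g(s_i)Δf = Δ(gf) - Δg · f(s_{i+1}) and Δg = ∫ g', so only the oscillation
  -- of f on each cell is left.
  have hkey : ∑ i ∈ Finset.range (N + 1), g (s i) • (f (s (i + 1)) - f (s i))
      - (g t • f t - g 0 • f 0 - ∫ r in (0 : ℝ)..t, g' r • f r) =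
      ∑ i ∈ Finset.range (N + 1), ∫ r in (s i)..(s (i + 1)), g' r • (f r - f (s (i + 1))) := by
    have h₁ : g t • f t - g 0 • f 0 =
        ∑ i ∈ Finset.range (N + 1), (g (s (i + 1)) • f (s (i + 1)) - g (s i) • f (s i)) := by
      rw [Finset.sum_range_sub (fun i => g (s i) • f (s i)), hsN, hs0]
    have h₂ : ∫ r in (0 : ℝ)..t, g' r • f r =
        ∑ i ∈ Finset.range (N + 1), ∫ r in (s i)..(s (i + 1)), g' r • f r := by
      rw [intervalIntegral.sum_integral_adjacent_intervals
        fun i _ => hgf.intervalIntegrable _ _, hsN, hs0]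
    rw [h₁, h₂, ← Finset.sum_sub_distrib, ← Finset.sum_sub_distrib]
    refine Finset.sum_congr rfl fun i _ => ?_
    have h₃ : ∫ r in (s i)..(s (i + 1)), g' r • (f r - f (s (i + 1))) =
        (∫ r in (s i)..(s (i + 1)), g' r • f r) - (g (s (i + 1)) - g (s i)) • f (s (i + 1)) := by
      have hc : Continuous fun r => g' r • f (s (i + 1)) := hg'.smul continuous_const
      simp_rw [smul_sub]
      rw [intervalIntegral.integral_sub (hgf.intervalIntegrable _ _)
        (hc.intervalIntegrable _ _), intervalIntegral.integral_smul_const,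
        intervalIntegral.integral_eq_sub_of_hasDerivAt (fun r _ => hg r)
          (hg'.intervalIntegrable _ _)]
    rw [h₃, smul_sub, sub_smul]
    abel
  have hbound : ∀ i ∈ Finset.range (N + 1),
      ‖∫ r in (s i)..(s (i + 1)), g' r • (f r - f (s (i + 1)))‖ ≤ K * η * h := fun i hi => by
    obtain ⟨hi0, hit⟩ := hsmem i hi
    have hlen : |s (i + 1) - s i| = h := by
      rw [hs1, abs_of_nonneg (by nlinarith [hsle i, hs1 i])]
      simp only [hs]
      ring
    rw [← hlen]
    refine intervalIntegral.norm_integral_le_of_norm_le_const fun r hr => ?_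
    rw [Set.uIoc_of_le (hsle i)] at hr
    rw [norm_smul]
    have hrm : r ∈ Set.Icc 0 t := ⟨hi0.trans hr.1.le, hr.2.trans hit⟩
    have hd : dist r (s (i + 1)) < δ := by
      rw [Real.dist_eq, abs_sub_comm, abs_of_nonneg (by linarith [hr.2])]
      rw [abs_of_nonneg (by linarith [hsle i])] at hlen
      linarith [hr.1]
    refine mul_le_mul (hK r hrm) ?_ (norm_nonneg _) hK0
    rw [← dist_eq_norm]
    exact (hfδ r hrm _ ⟨hi0.trans (hsle i), hit⟩ hd).le
  rw [dist_eq_norm]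
  have hrw : ∀ i : ℕ, ((i : ℝ) + 1) * h = s (i + 1) := fun i => (hs1 i).symm
  simp_rw [hrw]
  rw [hkey]
  calc ‖∑ i ∈ Finset.range (N + 1), ∫ r in (s i)..(s (i + 1)), g' r • (f r - f (s (i + 1)))‖
      ≤ ∑ i ∈ Finset.range (N + 1), K * η * h := norm_sum_le_of_le _ hbound
    _ = K * t * η := by
        rw [Finset.sum_const, Finset.card_range, nsmul_eq_mul, hh]
        push_cast
        field_simp
    _ < ε := by
        rw [hη, mul_div_assoc', div_lt_iff₀ (by positivity)]
        nlinarith [mul_nonneg hK0 ht]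

end RiemannStieltjes

/-! ### Laws of Wiener sums. -/

section WienerSums

variable {Ω : Type*} [MeasurableSpace Ω] {P : Measure Ω} {n : ℕ}

/-- The Wiener integral over the grid of step `h` of the step function with values `c i`. -/
noncomputable def wienerSum {G : Type*} [AddCommGroup G] [Module ℝ G] (c : ℕ → ℝ) (h : ℝ≥0)
    (M : ℕ) (w : ℝ≥0 → G) : G :=
  ∑ i ∈ Finset.range M, c i • (w ((i + 1 : ℕ) * h) - w (i * h))

lemma measurable_wienerSum {G : Type*} [NormedAddCommGroup G] [NormedSpace ℝ G]
    [MeasurableSpace G] [BorelSpace G] [SecondCountableTopology G] (c : ℕ → ℝ) (h : ℝ≥0) (M : ℕ) :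
    Measurable (wienerSum c h M : (ℝ≥0 → G) → G) := by
  unfold wienerSum
  fun_prop

lemma wienerSum_apply (c : ℕ → ℝ) (h : ℝ≥0) (M : ℕ) (w : ℝ≥0 → EuclideanSpace ℝ (Fin n))
    (j : Fin n) : wienerSum c h M w j = wienerSum c h M (fun t => w t j) := by
  simp [wienerSum, WithLp.ofLp_sum]

/-- Increments over the grid are independent with law N(0, h), so characteristic functions multiply
and variances add. -/
lemma charFun_wienerSum_real {B : ℝ≥0 → Ω → ℝ} (hB : IsPreBrownianReal B P)
    (c : ℕ → ℝ) (h : ℝ≥0) (M : ℕ) (ξ : ℝ) :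
    charFun (P.map fun ω => wienerSum c h M (fun t => B t ω)) ξ =
      Complex.exp (-(((h * ∑ i ∈ Finset.range M, c i ^ 2) * ξ ^ 2 / 2 : ℝ) : ℂ)) := by
  have hmono : Monotone fun i : ℕ => (i : ℝ≥0) * h := fun i j hij => by
    dsimp only
    gcongr
  have hind := hB.hasIndepIncrements.nat hmono
  have hlaw : ∀ i : ℕ, P.map (fun ω => B ((i + 1 : ℕ) * h) ω - B (i * h) ω) = gaussianReal 0 h :=
    fun i => by
      have h₁ := (hB.hasLaw_sub ((i + 1 : ℕ) * h) (i * h)).map_eq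
      have h₂ : nndist (((i + 1 : ℕ) * h : ℝ≥0) : ℝ) ((i * h : ℝ≥0) : ℝ) = h := by
        rw [← NNReal.coe_inj, coe_nndist, Real.dist_eq]
        push_cast
        rw [add_mul, one_mul, add_sub_cancel_left, NNReal.abs_eq]
      exact h₁.trans (congrArg (gaussianReal 0) h₂)
  have hmeas : ∀ i : ℕ, AEMeasurable (fun ω => B ((i + 1 : ℕ) * h) ω - B (i * h) ω) P :=
    fun i => (hB.aemeasurable _).sub (hB.aemeasurable _)
  have hind' : iIndepFun (fun (i : ℕ) ω => c i • (B ((i + 1 : ℕ) * h) ω - B (i * h) ω)) P :=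
    hind.comp (fun i y => c i • y) fun i => by fun_prop
  have hmeas' : ∀ i ∈ Finset.range M,
      AEMeasurable (fun ω => c i • (B ((i + 1 : ℕ) * h) ω - B (i * h) ω)) P :=
    fun i _ => (hmeas i).const_smul (c i)
  unfold wienerSum
  rw [(hind'.restrict _).charFun_map_fun_finsetSum_eq_prod hmeas', Finset.prod_apply]
  have hterm : ∀ i : ℕ, charFun (P.map fun ω => c i • (B ((i + 1 : ℕ) * h) ω - B (i * h) ω)) ξ =
      Complex.exp (-((h * c i ^ 2 * ξ ^ 2 / 2 : ℝ) : ℂ)) := fun i => by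
    rw [charFun_map_smul_comp (hmeas i), hlaw, charFun_gaussianReal]
    congr 1
    push_cast
    simp
    ring
  simp_rw [hterm]
  rw [← Complex.exp_sum]
  congr 1
  push_cast
  rw [Finset.sum_neg_distrib, Finset.mul_sum, Finset.sum_mul, Finset.sum_div]

lemma IsStandardBrownianMotion.measurable_wienerSum
    {W : ℝ≥0 → Ω → EuclideanSpace ℝ (Fin n)} (hW : IsStandardBrownianMotion W P) (c : ℕ → ℝ)
    (h : ℝ≥0) (M : ℕ) : Measurable fun ω => wienerSum c h M (fun t => W t ω) :=
  (_root_.measurable_wienerSum c h M).comp (measurable_pi_lambda _ hW.measurable)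

/-- The coordinates are independent with a common variance, so the product of their characteristic
functions depends on ‖ξ‖ alone. -/
lemma map_wienerSum [IsProbabilityMeasure P] {W : ℝ≥0 → Ω → EuclideanSpace ℝ (Fin n)}
    (hW : IsStandardBrownianMotion W P) (c : ℕ → ℝ) (h : ℝ≥0) (M : ℕ) :
    P.map (fun ω => wienerSum c h M (fun t => W t ω)) =
      (stdGaussian (EuclideanSpace ℝ (Fin n))).map
        (√(h * ∑ i ∈ Finset.range M, c i ^ 2) • ·) := by
  have hS := hW.measurable_wienerSum c h M
  have := Measure.isProbabilityMeasure_map (μ := P) hS.aemeasurable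
  have hV : (0 : ℝ) ≤ h * ∑ i ∈ Finset.range M, c i ^ 2 :=
    mul_nonneg h.2 (Finset.sum_nonneg fun _ _ => sq_nonneg _)
  have hind : iIndepFun (fun (j : Fin n) ω => wienerSum c h M (fun t => W t ω j)) P :=
    hW.iIndepFun.comp (fun _ w => wienerSum c h M w) fun _ => measurable_wienerSum c h M
  have hmeas : ∀ j : Fin n, AEMeasurable (fun ω => wienerSum c h M (fun t => W t ω j)) P := fun j =>
    ((measurable_wienerSum c h M).comp (measurable_pi_lambda _ fun t =>
      (by have := hW.measurable t; fun_prop : Measurable fun ω => W t ω j))).aemeasurable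
  have hvec : (fun ω => wienerSum c h M (fun t => W t ω)) =
      fun ω => WithLp.toLp 2 fun j => wienerSum c h M (fun t => W t ω j) := by
    ext ω j
    exact wienerSum_apply c h M _ j
  refine Measure.ext_of_charFun (funext fun ξ => ?_)
  rw [charFun_map_smul, charFun_stdGaussian, hvec, (iIndepFun_iff_charFun_pi hmeas).1 hind]
  simp_rw [fun j => charFun_wienerSum_real (hW.isBrownianReal j).toIsPreBrownianReal c h M (ξ j)]
  rw [← Complex.exp_sum]
  congr 1
  rw [Finset.sum_neg_distrib, ← Complex.ofReal_sum, ← Finset.sum_div, ← Finset.mul_sum, norm_smul,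
    Real.norm_of_nonneg (Real.sqrt_nonneg _)]
  rw [← Complex.ofReal_pow, mul_pow, Real.sq_sqrt hV, EuclideanSpace.real_norm_sq_eq]
  push_cast
  ring

end WienerSums

/-! ### Passing to the limit in joint laws. -/

section LimitLaw

variable {Ω E : Type*} [MeasurableSpace Ω] {P : Measure Ω} [IsProbabilityMeasure P]
  [NormedAddCommGroup E] [NormedSpace ℝ E] [MeasurableSpace E] [BorelSpace E]
  [SecondCountableTopology E]

/-- Almost sure limits of variables which are independent of `X` and have law `γ` scaled by
`v N` are independent of `X` and have law `γ` scaled by `lim v`. -/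
lemma map_prodMk_eq_of_tendsto {γ : Measure E} [IsProbabilityMeasure γ] {X D : Ω → E}
    (hX : Measurable X) (hD : Measurable D) {S : ℕ → Ω → E} (hS : ∀ N, Measurable (S N))
    (hind : ∀ N, IndepFun X (S N) P) {v : ℕ → ℝ} {v' : ℝ} (hv : Tendsto v atTop (𝓝 v'))
    (hlaw : ∀ N, P.map (S N) = γ.map (v N • ·))
    (hlim : ∀ᵐ ω ∂P, Tendsto (fun N => S N ω) atTop (𝓝 (D ω))) :
    P.map (fun ω => (X ω, D ω)) = ((P.map X).prod γ).map fun y => (y.1, v' • y.2) := by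
  have := Measure.isProbabilityMeasure_map (μ := P) hX.aemeasurable
  have hsc : ∀ r : ℝ, Measurable fun y : E × E => (y.1, r • y.2) := fun r => by fun_prop
  have hjoint : ∀ N, P.map (fun ω => (X ω, S N ω)) =
      ((P.map X).prod γ).map fun y => (y.1, v N • y.2) := fun N => by
    rw [(indepFun_iff_map_prod_eq_prod_map_map hX.aemeasurable (hS N).aemeasurable).1 (hind N),
      hlaw]
    conv_lhs => rw [← Measure.map_id (μ := P.map X)]
    exact Measure.map_prod_map _ _ measurable_id (by fun_prop)
  have := Measure.isProbabilityMeasure_map (μ := P) (hX.prodMk hD).aemeasurable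
  have := Measure.isProbabilityMeasure_map (μ := (P.map X).prod γ) (hsc v').aemeasurable
  -- Bounded continuous test functions determine the law; dominated convergence applies to both
  -- descriptions of the approximating law.
  refine ext_of_forall_integral_eq_of_IsFiniteMeasure fun f => ?_
  have hfm : StronglyMeasurable f := f.continuous.measurable.stronglyMeasurable
  rw [integral_map (hX.prodMk hD).aemeasurable hfm.aestronglyMeasurable,
    integral_map (hsc v').aemeasurable hfm.aestronglyMeasurable]
  have h₁ : Tendsto (fun N => ∫ ω, f (X ω, S N ω) ∂P) atTop (𝓝 (∫ ω, f (X ω, D ω) ∂P)) := by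
    refine tendsto_integral_of_dominated_convergence (fun _ => ‖f‖)
      (fun N => (hfm.comp_measurable (hX.prodMk (hS N))).aestronglyMeasurable)
      (integrable_const _) (fun N => ae_of_all _ fun ω => f.norm_coe_le_norm _) ?_
    filter_upwards [hlim] with ω hω
    exact (f.continuous.tendsto _).comp (tendsto_const_nhds.prodMk_nhds hω)
  have h₂ : Tendsto (fun N => ∫ y, f (y.1, v N • y.2) ∂(P.map X).prod γ) atTop
      (𝓝 (∫ y, f (y.1, v' • y.2) ∂(P.map X).prod γ)) := by
    refine tendsto_integral_of_dominated_convergence (fun _ => ‖f‖)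
      (fun N => (hfm.comp_measurable (hsc _)).aestronglyMeasurable)
      (integrable_const _) (fun N => ae_of_all _ fun ω => f.norm_coe_le_norm _)
      (ae_of_all _ fun y => ?_)
    exact (f.continuous.tendsto _).comp (tendsto_const_nhds.prodMk_nhds (hv.smul_const y.2))
  refine tendsto_nhds_unique h₁ (h₂.congr fun N => ?_)
  rw [← integral_map (hsc _).aemeasurable hfm.aestronglyMeasurable, ← hjoint,
    integral_map (hX.prodMk (hS N)).aemeasurable hfm.aestronglyMeasurable]

end LimitLaw

/-! ### Variation of constants along a path. -/

section VariationOfConstants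

variable {F : Type*} [NormedAddCommGroup F] [NormedSpace ℝ F] [CompleteSpace F]

/-- Variation of constants: integrating `exp (α s)` against the driving path of the equation
`x t = x 0 - α ∫₀ᵗ x + f t`. -/
lemma exp_smul_sub_integral_eq {x : ℝ → F} (hx : Continuous x) (α t : ℝ) :
    Real.exp (α * t) • (x t - x 0 + α • ∫ s in (0 : ℝ)..t, x s)
      - Real.exp (α * 0) • (x 0 - x 0 + α • ∫ s in (0 : ℝ)..0, x s)
      - ∫ s in (0 : ℝ)..t, (α * Real.exp (α * s)) • (x s - x 0 + α • ∫ r in (0 : ℝ)..s, x r) =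
    Real.exp (α * t) • x t - x 0 := by
  have hY : ∀ s, HasDerivAt (fun s => ∫ r in (0 : ℝ)..s, x r) (x s) s := fun s =>
    intervalIntegral.integral_hasDerivAt_right (hx.intervalIntegrable _ _)
      (hx.stronglyMeasurableAtFilter _ _) hx.continuousAt
  have hYc : Continuous fun s => ∫ r in (0 : ℝ)..s, x r :=
    continuous_iff_continuousAt.2 fun s => (hY s).continuousAt
  have hexp : ∀ s, HasDerivAt (fun s => Real.exp (α * s)) (α * Real.exp (α * s)) s := fun s => by
    have h := ((hasDerivAt_id s).const_mul α).exp
    refine h.congr_deriv ?_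
    simp [mul_comm]
  have hprim : ∀ s, HasDerivAt
      (fun s => Real.exp (α * s) • (α • (∫ r in (0 : ℝ)..s, x r) - x 0))
      ((α * Real.exp (α * s)) • (x s - x 0 + α • ∫ r in (0 : ℝ)..s, x r)) s := fun s => by
    refine ((hexp s).smul (((hY s).const_smul α).sub_const (x 0))).congr_deriv ?_
    simp only [Pi.smul_apply]
    module
  have hcont : Continuous fun s =>
      (α * Real.exp (α * s)) • (x s - x 0 + α • ∫ r in (0 : ℝ)..s, x r) := by fun_prop
  rw [intervalIntegral.integral_eq_sub_of_hasDerivAt (fun s _ => hprim s)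
    (hcont.intervalIntegrable _ _), intervalIntegral.integral_same, mul_zero, Real.exp_zero]
  module

end VariationOfConstants

/-! ### The joint law of the Ornstein–Uhlenbeck process. -/

section OrnsteinUhlenbeck

variable {Ω : Type*} [MeasurableSpace Ω] {P : Measure Ω} {n : ℕ}
  {α : ℝ} {X W : ℝ≥0 → Ω → EuclideanSpace ℝ (Fin n)}

/-- The Wiener sums of `exp (α s)` converge along almost every path. -/
lemma IsOUProcess.tendsto_wienerSum (hX : IsOUProcess α X W P) (t : ℝ≥0) :
    ∀ᵐ ω ∂P, Tendsto (fun N : ℕ => √2 • wienerSum (fun i => Real.exp (α * (i * (t / (N + 1)))))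
      (t / (N + 1)) (N + 1) (fun s => W s ω)) atTop
      (𝓝 (Real.exp (α * t) • X t ω - X 0 ω)) := by
  filter_upwards [hX.continuous_paths, hX.equation] with ω hcont heq
  have hx : Continuous fun s : ℝ => X s.toNNReal ω := hcont.comp continuous_real_toNNReal
  have hYc : Continuous fun s => ∫ r in (0 : ℝ)..s, X r.toNNReal ω :=
    intervalIntegral.continuous_primitive (fun a b => hx.intervalIntegrable a b) 0
  -- The equation is solved for the noise, whose continuity then follows from that of the path of X.
  have hW : ∀ s : ℝ≥0, √2 • W s ω = X s ω - X 0 ω + α • ∫ r in (0 : ℝ)..s, X r.toNNReal ω :=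
    fun s => by
      have h := heq s
      rw [intervalIntegral.integral_smul] at h
      rw [h]
      module
  have hexp : ∀ s, HasDerivAt (fun s => Real.exp (α * s)) (α * Real.exp (α * s)) s := fun s => by
    refine ((hasDerivAt_id s).const_mul α).exp.congr_deriv ?_
    simp [mul_comm]
  have hf : Continuous fun s : ℝ =>
      X s.toNNReal ω - X 0 ω + α • ∫ r in (0 : ℝ)..s, X r.toNNReal ω := by fun_prop
  have h := tendsto_sum_smul_sub hf hexp (by fun_prop) t.2
  -- Its boundary terms at 0 are left unsimplified so as to match the limit in `h`.
  have hvc := exp_smul_sub_integral_eq hx α t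
  simp only [Real.toNNReal_zero, Real.toNNReal_coe] at hvc
  simp only [Real.toNNReal_zero, NNReal.val_eq_coe, Real.toNNReal_coe] at h
  rw [hvc] at h
  refine h.congr fun N => ?_
  rw [wienerSum, Finset.smul_sum]
  refine Finset.sum_congr rfl fun i _ => ?_
  have h₁ : ∀ m : ℕ, (m : ℝ) * ((t : ℝ) / (N + 1)) = ((m * (t / (N + 1)) : ℝ≥0) : ℝ) :=
    fun m => by push_cast; rfl
  have h₂ : ((i : ℝ) + 1) * ((t : ℝ) / (N + 1)) = (((i + 1 : ℕ) * (t / (N + 1)) : ℝ≥0) : ℝ) := by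
    push_cast
    rfl
  rw [h₂, h₁, Real.toNNReal_coe, Real.toNNReal_coe, ← hW, ← hW, ← smul_sub, smul_comm]

/-- The variances of the Wiener sums of `exp (α s)` converge. -/
lemma tendsto_variance_wienerSum (hα : 0 < α) (t : ℝ≥0) :
    Tendsto (fun N : ℕ => ((t / (N + 1) : ℝ≥0) : ℝ) * ∑ i ∈ Finset.range (N + 1),
      Real.exp (α * (i * (t / (N + 1)))) ^ 2) atTop
      (𝓝 ((Real.exp (2 * α * t) - 1) / (2 * α))) := by
  have hexp : ∀ s, HasDerivAt (fun s => Real.exp (2 * α * s)) (2 * α * Real.exp (2 * α * s)) s :=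
    fun s => by
      refine ((hasDerivAt_id s).const_mul (2 * α)).exp.congr_deriv ?_
      simp [mul_comm]
  -- With the identity as integrator these are Riemann sums of exp(2αs); the limit appears
  -- integrated by parts.
  have h := tendsto_sum_smul_sub continuous_id hexp (by fun_prop) t.2
  have hprim : ∀ s, HasDerivAt
      (fun s => Real.exp (2 * α * s) * s - Real.exp (2 * α * s) / (2 * α))
      ((2 * α * Real.exp (2 * α * s)) • id s) s := fun s => by
    refine (((hexp s).mul (hasDerivAt_id s)).sub ((hexp s).div_const (2 * α))).congr_deriv ?_
    simp only [smul_eq_mul, id]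
    field_simp
    ring
  have hcont : Continuous fun s => (2 * α * Real.exp (2 * α * s)) • id s := by fun_prop
  rw [intervalIntegral.integral_eq_sub_of_hasDerivAt (fun s _ => hprim s)
    (hcont.intervalIntegrable _ _)] at h
  refine (h.congr fun N => ?_).trans_eq ?_
  · rw [Finset.mul_sum]
    refine Finset.sum_congr rfl fun i _ => ?_
    rw [← Real.exp_nat_mul]
    simp only [NNReal.val_eq_coe, id, smul_eq_mul]
    push_cast
    ring_nf
  · congr 1
    simp
    field_simp
    ring

/-- The signal-to-noise amplitude of the Ornstein–Uhlenbeck channel at time `t`. -/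
noncomputable def ouScale (α t : ℝ) : ℝ := √(α / (Real.exp (2 * α * t) - 1))

lemma exp_sub_one_pos (hα : 0 < α) {t : ℝ} (ht : 0 < t) : 0 < Real.exp (2 * α * t) - 1 := by
  have h := Real.add_one_lt_exp (x := 2 * α * t) (by positivity)
  have : 0 < 2 * α * t := by positivity
  linarith

lemma ouScale_pos (hα : 0 < α) {t : ℝ} (ht : 0 < t) : 0 < ouScale α t :=
  Real.sqrt_pos.2 (div_pos hα (exp_sub_one_pos hα ht))

/-- The joint law of the initial value and the value at time `t`. -/
lemma IsOUProcess.map_prodMk [IsProbabilityMeasure P] (hX : IsOUProcess α X W P) (hα : 0 < α)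
    {t : ℝ≥0} (ht : 0 < t) :
    P.map (fun ω => (X 0 ω, X t ω)) =
      ((P.map (X 0)).prod (stdGaussian (EuclideanSpace ℝ (Fin n)))).map fun y =>
        (y.1, (Real.exp (-(α * t)) / ouScale α t) • (ouScale α t • y.1 + y.2)) := by
  set c : ℕ → ℕ → ℝ := fun N i => Real.exp (α * (i * (t / (N + 1))))
  set h : ℕ → ℝ≥0 := fun N => t / (N + 1)
  have hΦ : ∀ N, Measurable fun w : ℝ≥0 → EuclideanSpace ℝ (Fin n) =>
      √2 • wienerSum (c N) (h N) (N + 1) w := fun N => by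
    have := fun N => measurable_wienerSum (G := EuclideanSpace ℝ (Fin n)) (c N) (h N) (N + 1)
    fun_prop
  have ha := ouScale_pos hα (t := t) (by exact_mod_cast ht)
  -- √2 times the root of (e^{2αt} - 1)/(2α) is 1 / `ouScale α t`.
  have hv : Tendsto (fun N => √2 * √(h N * ∑ i ∈ Finset.range (N + 1), c N i ^ 2)) atTop
      (𝓝 (ouScale α t)⁻¹) := by
    have h₁ := (tendsto_variance_wienerSum hα t).sqrt.const_mul √2
    convert h₁ using 2
    rw [ouScale, ← Real.sqrt_mul (by norm_num), ← Real.sqrt_inv]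
    congr 1
    field_simp
  have hD : Measurable fun ω => Real.exp (α * t) • X t ω - X 0 ω := by
    have h₀ := hX.measurable 0
    have h₁ := hX.measurable t
    fun_prop
  have hS : ∀ N, Measurable fun ω => wienerSum (c N) (h N) (N + 1) (fun s => W s ω) :=
    fun N => hX.brownian.measurable_wienerSum (c N) (h N) (N + 1)
  have hlaw : ∀ N, P.map (fun ω => √2 • wienerSum (c N) (h N) (N + 1) (fun s => W s ω)) =
      (stdGaussian (EuclideanSpace ℝ (Fin n))).map
        ((√2 * √(h N * ∑ i ∈ Finset.range (N + 1), c N i ^ 2)) • ·) := fun N => by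
    have h₁ := Measure.map_map (μ := P) (g := fun z : EuclideanSpace ℝ (Fin n) => √2 • z)
      (measurable_const_smul _) (hS N)
    rw [map_wienerSum hX.brownian, Measure.map_map (by fun_prop) (by fun_prop)] at h₁
    refine h₁.symm.trans ?_
    congr 1
    ext1 z
    exact smul_smul _ _ _
  have hind : ∀ N, IndepFun (X 0)
      (fun ω => √2 • wienerSum (c N) (h N) (N + 1) (fun s => W s ω)) P :=
    fun N => hX.indep.comp measurable_id (hΦ N)
  have key := map_prodMk_eq_of_tendsto (hX.measurable 0) hD (fun N => (hS N).const_smul √2)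
    hind hv hlaw (hX.tendsto_wienerSum t)
  have hψ : Measurable fun y : EuclideanSpace ℝ (Fin n) × EuclideanSpace ℝ (Fin n) =>
      (y.1, Real.exp (-(α * t)) • (y.1 + y.2)) := by fun_prop
  -- This map recovers (X_0, X_t) from (X_0, e^{αt} X_t - X_0).
  have h₂ := congrArg (Measure.map fun y : EuclideanSpace ℝ (Fin n) × EuclideanSpace ℝ (Fin n) =>
      (y.1, Real.exp (-(α * t)) • (y.1 + y.2))) key
  rw [Measure.map_map hψ ((hX.measurable 0).prodMk hD),
    Measure.map_map hψ (by fun_prop)] at h₂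
  have hl : ((fun y : EuclideanSpace ℝ (Fin n) × EuclideanSpace ℝ (Fin n) =>
      (y.1, Real.exp (-(α * t)) • (y.1 + y.2))) ∘
        fun ω => (X 0 ω, Real.exp (α * t) • X t ω - X 0 ω)) = fun ω => (X 0 ω, X t ω) := by
    funext ω
    simp only [Function.comp, add_sub_cancel, smul_smul, ← Real.exp_add, neg_add_cancel,
      Real.exp_zero, one_smul]
  have hr : ((fun y : EuclideanSpace ℝ (Fin n) × EuclideanSpace ℝ (Fin n) =>
      (y.1, Real.exp (-(α * t)) • (y.1 + y.2))) ∘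
        fun y : EuclideanSpace ℝ (Fin n) × EuclideanSpace ℝ (Fin n) =>
          (y.1, (ouScale α t)⁻¹ • y.2)) =
      fun y => (y.1, (Real.exp (-(α * t)) / ouScale α t) • (ouScale α t • y.1 + y.2)) := by
    funext y
    simp only [Function.comp, smul_add, smul_smul]
    rw [div_mul_cancel₀ _ ha.ne', div_eq_mul_inv]
  rw [← hl, ← hr]
  exact h₂

end OrnsteinUhlenbeck

/-! ### Time dependence of the scale, and iterated derivatives. -/

section OUScale

variable {α : ℝ}

/-- Substituting e^{2αt} = 1 + α/a² eliminates t and leaves an autonomous polynomial equation for a,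
so time derivatives stay in the algebra. -/
lemma hasDerivAt_ouScale (hα : 0 < α) {t : ℝ} (ht : 0 < t) :
    HasDerivAt (ouScale α) (-1 * (ouScale α t * (ouScale α t * ouScale α t + α))) t := by
  have hpos := exp_sub_one_pos hα ht
  have hq : 0 < α / (Real.exp (2 * α * t) - 1) := div_pos hα hpos
  have hexp : HasDerivAt (fun s => Real.exp (2 * α * s) - 1) (2 * α * Real.exp (2 * α * t)) t := by
    refine (((hasDerivAt_id t).const_mul (2 * α)).exp.sub_const 1).congr_deriv ?_
    simp [mul_comm]
  have h := ((hasDerivAt_const t α).div hexp hpos.ne').sqrt hq.ne'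
  refine h.congr_deriv ?_
  have hs : ouScale α t ≠ 0 := (ouScale_pos hα ht).ne'
  have hsq : ouScale α t * ouScale α t = α / (Real.exp (2 * α * t) - 1) :=
    Real.mul_self_sqrt hq.le
  change _ / (2 * ouScale α t) = _
  rw [div_eq_iff (by positivity)]
  have h₂ : -1 * (ouScale α t * (ouScale α t * ouScale α t + α)) * (2 * ouScale α t) =
      -2 * (ouScale α t * ouScale α t) * (ouScale α t * ouScale α t + α) := by ring
  rw [h₂, hsq]
  field_simp
  ring

lemma tendsto_ouScale (hα : 0 < α) : Tendsto (ouScale α) (𝓝[>] 0) atTop := by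
  refine Real.tendsto_sqrt_atTop.comp ?_
  have h : Tendsto (fun t => Real.exp (2 * α * t) - 1) (𝓝[>] 0) (𝓝[>] 0) := by
    refine tendsto_nhdsWithin_iff.2 ⟨?_, ?_⟩
    · have hc : Continuous fun t => Real.exp (2 * α * t) - 1 := by fun_prop
      have h₀ := hc.tendsto 0
      simp only [mul_zero, Real.exp_zero, sub_self] at h₀
      exact h₀.mono_left nhdsWithin_le_nhds
    · filter_upwards [self_mem_nhdsWithin] with t ht using exp_sub_one_pos hα ht
  simpa only [div_eq_mul_inv, Function.comp_def] using
    (tendsto_inv_nhdsGT_zero.comp h).const_mul_atTop hα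

end OUScale

lemma contDiffOn_of_forall_exists_deriv {𝒜 : Set (ℝ → ℝ)} {s : Set ℝ} (hs : IsOpen s)
    (h : ∀ f ∈ 𝒜, ∃ g ∈ 𝒜, ∀ t ∈ s, HasDerivAt f (g t) t) {f : ℝ → ℝ} (hf : f ∈ 𝒜) :
    ContDiffOn ℝ (⊤ : ℕ∞) f s := by
  refine contDiffOn_infty.2 fun m => ?_
  induction m generalizing f with
  | zero =>
    obtain ⟨g, -, hd⟩ := h f hf
    exact contDiffOn_zero.2 fun t ht => (hd t ht).continuousAt.continuousWithinAt
  | succ m ih =>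
    obtain ⟨g, hg, hd⟩ := h f hf
    have h₁ := (contDiffOn_succ_iff_deriv_of_isOpen (𝕜 := ℝ) (f := f) (n := m) hs).2
      ⟨fun t ht => (hd t ht).differentiableAt.differentiableWithinAt, by simp,
        (ih hg).congr fun t ht => (hd t ht).deriv⟩
    exact_mod_cast h₁

/-- Only the derivative of f has to lie in the family: mutual information is not itself an
expectation of a decaying function by construction, but its derivative is. -/
lemma exists_eqOn_iteratedDeriv {𝒜 : Set (ℝ → ℝ)} {s : Set ℝ} (hs : IsOpen s)
    (h : ∀ f ∈ 𝒜, ∃ g ∈ 𝒜, ∀ t ∈ s, HasDerivAt f (g t) t) {f g : ℝ → ℝ} (hg : g ∈ 𝒜)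
    (hfg : ∀ t ∈ s, HasDerivAt f (g t) t) (m : ℕ) :
    ∃ u ∈ 𝒜, Set.EqOn (iteratedDeriv (m + 1) f) u s := by
  induction m with
  | zero => exact ⟨g, hg, fun t ht => by rw [zero_add, iteratedDeriv_one, (hfg t ht).deriv]⟩
  | succ m ih =>
    obtain ⟨u, hu, heq⟩ := ih
    obtain ⟨v, hv, hd⟩ := h u hu
    refine ⟨v, hv, fun t ht => ?_⟩
    rw [iteratedDeriv_succ]
    exact ((hd t ht).congr_of_eventuallyEq (heq.eventuallyEq_of_mem (hs.mem_nhds ht))).deriv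

/-! ### Time derivatives of expectations, and the conclusion. -/

namespace PointMixture

variable {E : Type*} [NormedAddCommGroup E] [InnerProductSpace ℝ E] {k : ℕ} {p : Fin k → ℝ}
  {x : Fin k → E} {α : ℝ}

lemma tame_ouScale_deriv : Tame p x fun a _ => -1 * (a * (a * a + α)) :=
  (Tame.const _).mul (Tame.scale.mul ((Tame.scale.mul .scale).add (.const α)))

variable [FiniteDimensional ℝ E] [MeasurableSpace E] [BorelSpace E]

lemma hasDerivAt_integral_ouScale (hp : ∀ i, 0 < p i) (hp_sum : ∑ i, p i = 1) (hα : 0 < α)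
    {f g : ℝ → E → ℝ} (hf : Tame p x f) (hg : Tame p x g)
    (h : ∀ a z, HasDerivAt (fun a => f a z) (g a z) a) {t : ℝ} (ht : 0 < t) :
    HasDerivAt (fun t => ∫ z, f (ouScale α t) z ∂stdGaussian E)
      (∫ z, g (ouScale α t) z * (-1 * (ouScale α t * (ouScale α t * ouScale α t + α)))
        ∂stdGaussian E) t := by
  rw [integral_mul_const]
  exact (hf.hasDerivAt_integral hp hp_sum hg h _).comp t (hasDerivAt_ouScale hα ht)

/-- Expectations of tame functions are smooth in time. -/
lemma contDiffOn_integral_ouScale (hp : ∀ i, 0 < p i) (hp_sum : ∑ i, p i = 1) (hα : 0 < α)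
    {f : ℝ → E → ℝ} (hf : Tame p x f) :
    ContDiffOn ℝ (⊤ : ℕ∞) (fun t => ∫ z, f (ouScale α t) z ∂stdGaussian E) (Set.Ioi 0) := by
  refine contDiffOn_of_forall_exists_deriv
    (𝒜 := {u | ∃ f, Tame p x f ∧ u = fun t => ∫ z, f (ouScale α t) z ∂stdGaussian E})
    isOpen_Ioi ?_ ⟨f, hf, rfl⟩
  rintro _ ⟨f, hf, rfl⟩
  obtain ⟨g, hg, hd⟩ := hf.exists_deriv hp
  exact ⟨_, ⟨_, hg.mul tame_ouScale_deriv, rfl⟩,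
    fun t ht => hasDerivAt_integral_ouScale hp hp_sum hα hf hg hd ht⟩

/-- If the scale derivative of a tame function is decaying, then all time derivatives of its
expectation vanish at time zero. -/
lemma tendsto_iteratedDeriv_integral_ouScale (hp : ∀ i, 0 < p i) (hp_sum : ∑ i, p i = 1)
    (hx : Function.Injective x) (hα : 0 < α) {f g : ℝ → E → ℝ} (hf : Tame p x f)
    (hg : Decaying p x g) (h : ∀ a z, HasDerivAt (fun a => f a z) (g a z) a) (m : ℕ) :
    Tendsto (iteratedDeriv (m + 1) fun t => ∫ z, f (ouScale α t) z ∂stdGaussian E)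
      (𝓝[>] 0) (𝓝 0) := by
  obtain ⟨_, ⟨u, hu, rfl⟩, heq⟩ := exists_eqOn_iteratedDeriv
    (𝒜 := {u | ∃ f, Decaying p x f ∧ u = fun t => ∫ z, f (ouScale α t) z ∂stdGaussian E})
    isOpen_Ioi (fun _ ⟨f, hf, hu⟩ => by
      obtain ⟨g, hg, hd⟩ := hf.exists_deriv hp
      subst hu
      exact ⟨_, ⟨_, hg.mul_tame tame_ouScale_deriv, rfl⟩,
        fun t ht => hasDerivAt_integral_ouScale hp hp_sum hα hf.tame hg.tame hd ht⟩)
    ⟨_, hg.mul_tame tame_ouScale_deriv, rfl⟩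
    (fun t ht => hasDerivAt_integral_ouScale hp hp_sum hα hf hg.tame h ht) m
  exact ((hu.tendsto_integral hp hp_sum hx).comp (tendsto_ouScale hα)).congr'
    (heq.symm.eventuallyEq_of_mem self_mem_nhdsWithin)

end PointMixture

theorem corollary1 {Ω : Type*} [MeasurableSpace Ω] (P : Measure Ω) [IsProbabilityMeasure P]
    (n k : ℕ) (α : ℝ) (hα : 0 < α)
    (p : Fin k → ℝ) (hp : ∀ i, 0 < p i) (hp_sum : ∑ i, p i = 1)
    (μ : Fin k → EuclideanSpace ℝ (Fin n)) (hμ : Function.Injective μ)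
    (X W : ℝ≥0 → Ω → EuclideanSpace ℝ (Fin n)) (hX : IsOUProcess α X W P)
    (hX0 : P.map (X 0) = ∑ i, ENNReal.ofReal (p i) • Measure.dirac (μ i)) :
    (∀ t : ℝ≥0, mutualInfo (X 0) (X t) P ≠ ∞) ∧
    ContDiffOn ℝ (⊤ : ℕ∞) (fun t : ℝ => (mutualInfo (X 0) (X t.toNNReal) P).toReal) (Set.Ioi 0) ∧
    ∀ ℓ : ℕ, 1 ≤ ℓ →
      Tendsto (iteratedDeriv ℓ (fun t : ℝ => (mutualInfo (X 0) (X t.toNNReal) P).toReal))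
        (𝓝[>] 0) (𝓝 0) := by
  -- Positivity of t is essential: at t = 0 division by zero makes `ouScale` equal to 0.
  have hMI : ∀ t : ℝ, 0 < t → (mutualInfo (X 0) (X t.toNNReal) P).toReal =
      ∫ z, ∑ i, p i * PointMixture.infoDensity p μ i (ouScale α t) z ∂stdGaussian _ := fun t ht => by
    have hpos : 0 < ouScale α t := ouScale_pos hα ht
    have hj := hX.map_prodMk hα (Real.toNNReal_pos.2 ht)
    rw [Real.coe_toNNReal t ht.le] at hj
    exact PointMixture.toReal_mutualInfo hp hp_sum (hX.measurable 0) (hX.measurable _) hX0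
      (div_pos (Real.exp_pos _) hpos).ne' hj
  have hT : PointMixture.Tame p μ fun a z => ∑ i, p i * PointMixture.infoDensity p μ i a z :=
    .sum _ fun i => (PointMixture.Tame.const _).mul (.infoDensity i)
  have hD : PointMixture.Decaying p μ fun a z => ∑ i,
      (∑ j, PointMixture.posterior p μ i j a z * PointMixture.logRatioDeriv μ i j a z * (-1)) *
        p i :=
    .sum _ fun i => (PointMixture.decaying_infoDensity_deriv i).mul_tame (.const (p i))
  have hd : ∀ a z, HasDerivAt (fun a => ∑ i, p i * PointMixture.infoDensity p μ i a z)
      (∑ i, (∑ j, PointMixture.posterior p μ i j a z * PointMixture.logRatioDeriv μ i j a z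
        * (-1)) * p i) a := fun a z => by
    refine (HasDerivAt.fun_sum fun i _ =>
      (PointMixture.hasDerivAt_infoDensity hp i a z).const_mul (p i)).congr_deriv ?_
    exact Finset.sum_congr rfl fun i _ => mul_comm _ _
  refine ⟨fun t => mutualInfo_ne_top_of_map_eq_sum_dirac hp (hX.measurable 0) (hX.measurable t)
    hX0, (PointMixture.contDiffOn_integral_ouScale hp hp_sum hα hT).congr fun t ht => hMI t ht,
    fun ℓ hℓ => ?_⟩
  obtain ⟨m, rfl⟩ := Nat.exists_eq_add_of_le' hℓ
  refine (PointMixture.tendsto_iteratedDeriv_integral_ouScale hp hp_sum hμ hα hT hD hd m).congr' ?_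
  filter_upwards [self_mem_nhdsWithin] with t ht
  -- The formula holds near each t > 0, which is all that iterated derivatives at t depend on.
  refine (Filter.EventuallyEq.iteratedDeriv_eq _ ?_).symm
  filter_upwards [Ioi_mem_nhds ht] with s hs using hMI s hs
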